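/- Let $S$ be a complex manifold and let $\mathcal V\to S$ be a variation of graded-polarized mixed Hodge structure: a $\mathbb Q$-local system of finite rank with a weight filtration $\mathcal W$ by $\mathbb Q$-local subsystems, a Hodge filtration $\mathcal F$ of $\mathcal V_{\mathbb C}\otimes\mathcal O_S$ by holomorphic subbundles with $\nabla\mathcal F^p\subseteq\Omega^1_S\otimes\mathcal F^{p-1}$ (where $\nabla$ is the Gauss–Manin connection), and flat rational bilinear forms on the $Gr^{\mathcal W}_k$ for which each $Gr^{\mathcal W}_k$ is a variation of pure polarized Hodge structure of weight $k$. On each fibre let $\mathcal V_s=\bigoplus_{p,q}I^{p,q}_s$ be Deligne's bigrading of $(\mathcal F_s,\mathcal W_s)$, that is, the unique one with $\mathcal F^p=\bigoplus_{r\ge p,s}I^{r,s}$, $\mathcal W_k=\bigoplus_{r+s\le k}I^{r,s}$ and $I^{p,q}\equiv\overline{I^{q,p}}$ modulo $\bigoplus_{r<p,s<q}I^{r,s}$. Put $\mathcal U^p=\bigoplus_q I^{p,q}$, and let $Y$ be the Deligne grading, the endomorphism that acts on $I^{p,q}$ as multiplication by $p+q$. Then the $\mathcal U^p$ are $C^\infty$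 subbundles, and $\nabla$ decomposes uniquely as $\nabla=\tau+\bar\partial+\partial+\theta$, where $$\bar\partial:\mathcal E^0(\mathcal U^p)\to\mathcal E^{0,1}(\mathcal U^p),\quad \partial:\mathcal E^0(\mathcal U^p)\to\mathcal E^{1,0}(\mathcal U^p),\quad \tau\in \mathrm{Hom}(\mathcal U^p,\mathcal U^{p+1})\otimes\mathcal E^{0,1},\quad \theta\in \mathrm{Hom}(\mathcal U^p,\mathcal U^{p-1})\otimes\mathcal E^{1,0}$$ for all $p$. For an endomorphism $\alpha$ write $\alpha^Y$ for its component of weight zero (eigenvalue $0$) relative to $\mathrm{ad}\,Y$, and let $\bar\theta$ be the complex conjugate of $\theta$, an endomorphism-valued $(0,1)$-form. Then: 1. $\tau=(\bar\theta)^Y$. 2. For each $p$, $\mathcal U^p$ is a holomorphic subbundle of $\mathcal V$ relative to the complex structure $\nabla^{0,1}$ if and only if $(\bar\theta)^Y$ vanishes on $\mathcal U^p$. 3. If $\mathcal U^p=0$ for all $p>b$, then $\mathcal U^b$ is a holomorphic subbundle of $\mathcal V$ relative to $\nabla^{0,1}$. -/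

import Mathlib

open scoped TensorProduct Manifold ContDiff Topology

noncomputable section

namespace MixedHodge

universe u v w

section LinearAlgebra

/-- The complexification `V_ℂ = ℂ ⊗ V` of a rational vector space. -/
abbrev Cx (V : Type v) [AddCommGroup V] [Module ℚ V] : Type v := ℂ ⊗[ℚ] V

/-- Complex conjugation `z ⊗ v ↦ z̄ ⊗ v` on `V_ℂ`. -/
def conj (V : Type v) [AddCommGroup V] [Module ℚ V] : Cx V →ₛₗ[starRingEnd ℂ] Cx V where
  toFun := LinearMap.rTensor V (Complex.conjAe.toLinearMap.restrictScalars ℚ)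
  map_add' := map_add _
  map_smul' := by
    intro c x
    induction x using TensorProduct.induction_on with
    | zero => simp
    | tmul z w => simp [TensorProduct.smul_tmul']
    | add x y hx hy => simp only [smul_add, map_add, hx, hy]

/-- The conjugate `ᾱ = conj ∘ α ∘ conj` of an endomorphism of `V_ℂ`. -/
def conjEnd {V : Type v} [AddCommGroup V] [Module ℚ V] (α : Module.End ℂ (Cx V)) :
    Module.End ℂ (Cx V) :=
  (conj V).comp (α.comp (conj V))

/-- The conjugate of a complex subspace of `V_ℂ`. -/
def conjSub {V : Type v} [AddCommGroup V] [Module ℚ V] (U : Submodule ℂ (Cx V)) :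
    Submodule ℂ (Cx V) :=
  U.map (conj V)

/-- A decreasing filtration `F` of `H_ℂ` is a pure Hodge structure of weight `k` on `H`:
it is finite, and `H_ℂ = F^p ⊕ conj F^q` whenever `p + q = k + 1`. -/
structure IsPureHodge {H : Type v} [AddCommGroup H] [Module ℚ H] (k : ℤ)
    (F : ℤ → Submodule ℂ (Cx H)) : Prop where
  antitone : Antitone F
  exists_top : ∃ a, F a = ⊤
  exists_bot : ∃ b, F b = ⊥
  isCompl : ∀ p q : ℤ, p + q = k + 1 → IsCompl (F p) (conjSub (F q))

/-- The rational bilinear form `Q` polarizes the pure Hodge structure `F` of weight `k`. -/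
structure IsPolarization {H : Type v} [AddCommGroup H] [Module ℚ H] (k : ℤ)
    (F : ℤ → Submodule ℂ (Cx H)) (Q : LinearMap.BilinForm ℚ H) : Prop where
  parity : ∀ x y, Q x y = (-1 : ℚ) ^ k * Q y x
  nondegenerate : Q.Nondegenerate
  /-- First Riemann bilinear relation. -/
  orthogonal : ∀ p : ℤ, ∀ x ∈ F p, ∀ y ∈ F (k - p + 1),
    LinearMap.BilinForm.baseChange ℂ Q x y = 0
  /-- Second Riemann bilinear relation: `i^(p-q) Q(x, x̄) > 0` on `H^{p,q} = F^p ∩ conj F^q`. -/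
  positive : ∀ p q : ℤ, p + q = k → ∀ x ∈ F p ⊓ conjSub (F q), x ≠ 0 →
    0 < (Complex.I ^ (p - q) * LinearMap.BilinForm.baseChange ℂ Q x (conj H x)).re ∧
      (Complex.I ^ (p - q) * LinearMap.BilinForm.baseChange ℂ Q x (conj H x)).im = 0

variable {V : Type v} [AddCommGroup V] [Module ℚ V]

/-- `Gr^W_k = W_k / W_{k-1}`, a rational vector space. -/
abbrev Gr (W : ℤ → Submodule ℚ V) (k : ℤ) : Type v :=
  W k ⧸ (W (k - 1)).submoduleOf (W k)

/-- The induced filtration `F^p Gr^W_k = (F^p ∩ W_k + W_{k-1}) / W_{k-1}`, as the image in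
`ℂ ⊗ Gr^W_k` of the subspace of `ℂ ⊗ W_k` that lies in `F^p`. -/
def grF (W : ℤ → Submodule ℚ V) (F : ℤ → Submodule ℂ (Cx V)) (k p : ℤ) :
    Submodule ℂ (Cx (Gr W k)) :=
  ((F p).comap ((W k).subtype.baseChange ℂ)).map
    (((W (k - 1)).submoduleOf (W k)).mkQ.baseChange ℂ)

/-- `(F, W)` is a mixed Hodge structure on `V`. -/
structure IsMHS (W : ℤ → Submodule ℚ V) (F : ℤ → Submodule ℂ (Cx V)) : Prop where
  monotone_W : Monotone W
  exists_W_bot : ∃ a, W a = ⊥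
  exists_W_top : ∃ b, W b = ⊤
  antitone_F : Antitone F
  exists_F_top : ∃ a, F a = ⊤
  exists_F_bot : ∃ b, F b = ⊥
  pure : ∀ k, IsPureHodge k (grF W F k)

/-- `I` is a bigrading of `(F, W)` with
`I^{p,q} = conj I^{q,p} mod ⨁_{r<p, s<q} I^{r,s}`. -/
structure IsDeligneBigrading (W : ℤ → Submodule ℚ V) (F : ℤ → Submodule ℂ (Cx V))
    (I : ℤ → ℤ → Submodule ℂ (Cx V)) : Prop where
  isInternal : DirectSum.IsInternal (fun pq : ℤ × ℤ => I pq.1 pq.2)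
  F_eq : ∀ p, F p = ⨆ (r : ℤ) (s : ℤ) (_ : p ≤ r), I r s
  W_eq : ∀ k, (W k).baseChange ℂ = ⨆ (r : ℤ) (s : ℤ) (_ : r + s ≤ k), I r s
  conj_mod : ∀ p q, I p q ⊔ (⨆ (r : ℤ) (s : ℤ) (_ : r < p ∧ s < q), I r s) =
    conjSub (I q p) ⊔ (⨆ (r : ℤ) (s : ℤ) (_ : r < p ∧ s < q), I r s)

/-- The Deligne bigrading `I^{p,q}` of `(F, W)`: the (unique) bigrading with
`I^{p,q} = conj I^{q,p} mod ⨁_{r<p, s<q} I^{r,s}`. -/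
def deligneI (W : ℤ → Submodule ℚ V) (F : ℤ → Submodule ℂ (Cx V)) :
    ℤ → ℤ → Submodule ℂ (Cx V) :=
  Classical.epsilon (IsDeligneBigrading W F)

open Classical in
/-- For a direct sum decomposition `⨁ I^{p,q}`, the semisimple endomorphism `Y` that acts on
`I^{p,q}` as multiplication by `p + q`. -/
def gradingOf (I : ℤ → ℤ → Submodule ℂ (Cx V)) : Module.End ℂ (Cx V) :=
  if h : DirectSum.IsInternal (fun pq : ℤ × ℤ => I pq.1 pq.2) then
    (DirectSum.toModule ℂ (ℤ × ℤ) (Cx V)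
        (fun pq => ((pq.1 + pq.2 : ℤ) : ℂ) • (I pq.1 pq.2).subtype)) ∘ₗ
      (LinearEquiv.ofBijective
        (DirectSum.coeLinearMap (fun pq : ℤ × ℤ => I pq.1 pq.2)) h).symm.toLinearMap
  else 0

/-- `ad Y = [Y, ·]` on endomorphisms. -/
def ad {M : Type v} [AddCommGroup M] [Module ℂ M] (Y : Module.End ℂ M) :
    Module.End ℂ (Module.End ℂ M) :=
  LinearMap.mulLeft ℂ Y - LinearMap.mulRight ℂ Y

open Classical in
/-- The component `α^Y` of weight zero of `α` relative to `ad Y`: the projection of `α` to the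
`0`-eigenspace of `ad Y` along the sum of the other eigenspaces (for semisimple `Y` these
two subspaces are complementary). -/
def adWeightZero {M : Type v} [AddCommGroup M] [Module ℂ M] (Y α : Module.End ℂ M) :
    Module.End ℂ M :=
  if h : IsCompl (Module.End.eigenspace (ad Y) (0 : ℂ))
      (⨆ (μ : ℂ) (_ : μ ≠ 0), Module.End.eigenspace (ad Y) μ) then
    Submodule.projection _ _ h α
  else 0

end LinearAlgebra

/-- A `ℚ`-local system of finite rank on `S`: its fibres, together with, around each point `s₀`,
a flat trivialization on an open set `dom s₀`, such that the transition maps between these are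
locally constant. (The value of `chart s₀ s` for `s ∉ dom s₀` is irrelevant.) -/
structure RationalLocalSystem (S : Type u) [TopologicalSpace S] where
  fiber : S → Type v
  [addCommGroup : ∀ s, AddCommGroup (fiber s)]
  [module : ∀ s, Module ℚ (fiber s)]
  rank : S → ℕ
  dom : S → Set S
  isOpen_dom : ∀ s₀, IsOpen (dom s₀)
  mem_dom : ∀ s₀, s₀ ∈ dom s₀
  chart : ∀ s₀ s, fiber s →ₗ[ℚ] (Fin (rank s₀) → ℚ)
  bijective_chart : ∀ s₀, ∀ s ∈ dom s₀, Function.Bijective (chart s₀ s)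
  locallyConstant : ∀ s₀ s₁, ∀ s ∈ dom s₀ ∩ dom s₁,
    ∃ A : (Fin (rank s₀) → ℚ) →ₗ[ℚ] (Fin (rank s₁) → ℚ),
      ∀ᶠ s' in 𝓝 s, chart s₁ s' = A ∘ₗ chart s₀ s'

attribute [instance] RationalLocalSystem.addCommGroup RationalLocalSystem.module

namespace RationalLocalSystem

variable {S : Type u} [TopologicalSpace S] (L : RationalLocalSystem.{u, v} S)

/-- Fibre at `s` of the complex vector bundle `E = 𝒱_ℂ ⊗ ℰ⁰_S`. -/
abbrev fiberC (s : S) : Type v := Cx (L.fiber s)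

/-- A (set-theoretic) section of the complex vector bundle. -/
abbrev Sec : Type max u v := ∀ s, L.fiberC s

/-- The complexified flat trivialization. -/
def chartC (s₀ s : S) : L.fiberC s →ₗ[ℂ] (Fin (L.rank s₀) → ℂ) :=
  (TensorProduct.piScalarRight ℚ ℂ ℂ (Fin (L.rank s₀))).toLinearMap ∘ₗ
    (L.chart s₀ s).baseChange ℂ

theorem bijective_chartC {s₀ s : S} (hs : s ∈ L.dom s₀) :
    Function.Bijective (L.chartC s₀ s) := by
  have h : (L.chartC s₀ s : L.fiberC s → _) =
      ((LinearEquiv.ofBijective _ (L.bijective_chart s₀ s hs)).baseChange ℚ ℂ _ _).trans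
        (TensorProduct.piScalarRight ℚ ℂ ℂ (Fin (L.rank s₀))) := by
    rfl
  rw [h]
  exact LinearEquiv.bijective _

/-- The complexified flat trivialization around `s`, at `s` itself. -/
def chartEquiv (s : S) : L.fiberC s ≃ₗ[ℂ] (Fin (L.rank s) → ℂ) :=
  LinearEquiv.ofBijective (L.chartC s s) (L.bijective_chartC (L.mem_dom s))

variable (E : Type w) [NormedAddCommGroup E] [NormedSpace ℂ E] [ChartedSpace E S]

/-- The section `σ` is smooth (`C^∞` over `ℝ`) at the points of the open set `N`. -/
def IsSmoothOn (σ : L.Sec) (N : Set S) : Prop :=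
  ∀ s ∈ N, ContMDiffAt 𝓘(ℝ, E) 𝓘(ℝ, Fin (L.rank s) → ℂ) ∞ (fun s' => L.chartC s s' (σ s')) s

variable {E}

/-- The Gauss–Manin connection: `∇_ξ σ` at `s` is the derivative of `σ` along the real tangent
vector `ξ ∈ T_s S = E`, taken in a flat trivialization. -/
def nabla (σ : L.Sec) (s : S) (ξ : E) : L.fiberC s :=
  (L.chartEquiv s).symm
    ((mfderiv 𝓘(ℝ, E) 𝓘(ℝ, Fin (L.rank s) → ℂ) (fun s' => L.chartC s s' (σ s')) s :
      E →L[ℝ] (Fin (L.rank s) → ℂ)) ξ)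

/-- The `(1,0)`-part of `∇`: covariant derivative along `ξ^{1,0} = (ξ - i Jξ)/2`. -/
def nabla10 (σ : L.Sec) (s : S) (ξ : E) : L.fiberC s :=
  (1 / 2 : ℂ) • (L.nabla σ s ξ - Complex.I • L.nabla σ s (Complex.I • ξ))

/-- The `(0,1)`-part of `∇`: covariant derivative along `ξ^{0,1} = (ξ + i Jξ)/2`. -/
def nabla01 (σ : L.Sec) (s : S) (ξ : E) : L.fiberC s :=
  (1 / 2 : ℂ) • (L.nabla σ s ξ + Complex.I • L.nabla σ s (Complex.I • ξ))

variable (E)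

/-- Holomorphic sections over the open set `N`, for the complex structure `∇^{0,1}`: smooth
sections killed by `∇^{0,1}`. -/
def IsHolomorphicOn (σ : L.Sec) (N : Set S) : Prop :=
  L.IsSmoothOn E σ N ∧ ∀ s ∈ N, ∀ ξ : E, L.nabla01 σ s ξ = 0

/-- The family of subspaces `U` is a `C^∞` subbundle: it has local smooth frames. -/
def IsSmoothSubbundle (U : ∀ s, Submodule ℂ (L.fiberC s)) : Prop :=
  ∀ s₀ : S, ∃ N : Set S, IsOpen N ∧ s₀ ∈ N ∧ ∃ (m : ℕ) (e : Fin m → L.Sec),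
    (∀ j, L.IsSmoothOn E (e j) N) ∧
    ∀ s ∈ N, LinearIndependent ℂ (fun j => e j s) ∧
      Submodule.span ℂ (Set.range fun j => e j s) = U s

/-- The family of subspaces `U` is a holomorphic subbundle for the complex structure `∇^{0,1}`:
it has local holomorphic frames. -/
def IsHolomorphicSubbundle (U : ∀ s, Submodule ℂ (L.fiberC s)) : Prop :=
  ∀ s₀ : S, ∃ N : Set S, IsOpen N ∧ s₀ ∈ N ∧ ∃ (m : ℕ) (e : Fin m → L.Sec),
    (∀ j, L.IsHolomorphicOn E (e j) N) ∧
    ∀ s ∈ N, LinearIndependent ℂ (fun j => e j s) ∧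
      Submodule.span ℂ (Set.range fun j => e j s) = U s

end RationalLocalSystem

/-- A variation of graded-polarized mixed Hodge structure over the complex manifold `S` modelled
on `E`. Holomorphy and horizontality of the filtrations induced on the `Gr^W_k` follow from
the conditions below and are therefore not listed separately. -/
structure VGPMHS (E : Type w) [NormedAddCommGroup E] [NormedSpace ℂ E]
    (S : Type u) [TopologicalSpace S] [ChartedSpace E S] extends
    RationalLocalSystem.{u, v} S where
  /-- The weight filtration. -/
  W : ∀ s, ℤ → Submodule ℚ (fiber s)
  /-- The Hodge filtration. -/
  F : ∀ s, ℤ → Submodule ℂ (Cx (fiber s))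
  /-- The graded polarizations. -/
  Q : ∀ s k, LinearMap.BilinForm ℚ (Gr (W s) k)
  /-- Each `W_k` is a local subsystem. -/
  flat_W : ∀ k s₀, ∀ s ∈ dom s₀, ∀ᶠ s' in 𝓝 s,
    (W s' k).map (chart s₀ s') = (W s k).map (chart s₀ s)
  /-- Each form `Q_k` takes locally constant values on flat local sections. -/
  flat_Q : ∀ k s₀, ∀ s ∈ dom s₀, ∀ᶠ s' in 𝓝 s, ∀ (x y : W s k) (x' y' : W s' k),
    chart s₀ s' x' = chart s₀ s x → chart s₀ s' y' = chart s₀ s y →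
      Q s' k (Submodule.Quotient.mk x') (Submodule.Quotient.mk y') =
        Q s k (Submodule.Quotient.mk x) (Submodule.Quotient.mk y)
  holomorphic_F : ∀ p, toRationalLocalSystem.IsHolomorphicSubbundle E (fun s => F s p)
  /-- Griffiths horizontality `∇ F^p ⊆ Ω¹ ⊗ F^{p-1}`. -/
  horizontal : ∀ (p : ℤ) (N : Set S), IsOpen N → ∀ σ : toRationalLocalSystem.Sec,
    toRationalLocalSystem.IsHolomorphicOn E σ N → (∀ s ∈ N, σ s ∈ F s p) →
      ∀ s ∈ N, ∀ ξ : E, toRationalLocalSystem.nabla σ s ξ ∈ F s (p - 1)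
  isMHS : ∀ s, IsMHS (W s) (F s)
  polarized : ∀ s k, IsPolarization k (grF (W s) (F s) k) (Q s k)

namespace VGPMHS

variable {E : Type w} [NormedAddCommGroup E] [NormedSpace ℂ E]
  {S : Type u} [TopologicalSpace S] [ChartedSpace E S] (𝒱 : VGPMHS.{u, v, w} E S)

/-- `𝓘^{p,q}_s = I^{p,q}_{(F_s, W_s)}`. -/
def I (s : S) (p q : ℤ) : Submodule ℂ (𝒱.fiberC s) :=
  deligneI (𝒱.W s) (𝒱.F s) p q

/-- `𝒰^p_s = ⨁_q I^{p,q}_{(F_s, W_s)}`. -/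
def U (p : ℤ) (s : S) : Submodule ℂ (𝒱.fiberC s) :=
  ⨆ q : ℤ, 𝒱.I s p q

/-- The Deligne grading. -/
def Y (s : S) : Module.End ℂ (𝒱.fiberC s) :=
  gradingOf (𝒱.I s)

/-- A decomposition `∇ = τ + ∂̄ + ∂ + θ` of the Gauss–Manin connection relative to `⨁ 𝒰^p`:
tensor fields `τ ∈ Hom(𝒰^p, 𝒰^{p+1}) ⊗ ℰ^{0,1}` and `θ ∈ Hom(𝒰^p, 𝒰^{p-1}) ⊗ ℰ^{1,0}` such that
the operators `∂̄ = ∇^{0,1} - τ` and `∂ = ∇^{1,0} - θ` map smooth local sections of `𝒰^p` to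
`𝒰^p`-valued forms. Forms of type `(1,0)` and `(0,1)` at `s` are `ℂ`-linear and conjugate-linear
functions on `T_s S = E`, evaluated on `ξ^{1,0}` and `ξ^{0,1}` respectively. -/
@[ext]
structure Decomposition where
  τ : ∀ s, E →ₛₗ[starRingEnd ℂ] Module.End ℂ (𝒱.fiberC s)
  θ : ∀ s, E →ₗ[ℂ] Module.End ℂ (𝒱.fiberC s)
  τ_mem : ∀ s ξ p, ∀ x ∈ 𝒱.U p s, τ s ξ x ∈ 𝒱.U (p + 1) s
  θ_mem : ∀ s ξ p, ∀ x ∈ 𝒱.U p s, θ s ξ x ∈ 𝒱.U (p - 1) s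
  dbar_mem : ∀ (p : ℤ) (N : Set S), IsOpen N → ∀ σ : 𝒱.Sec, 𝒱.IsSmoothOn E σ N →
    (∀ s ∈ N, σ s ∈ 𝒱.U p s) → ∀ s ∈ N, ∀ ξ : E, 𝒱.nabla01 σ s ξ - τ s ξ (σ s) ∈ 𝒱.U p s
  d_mem : ∀ (p : ℤ) (N : Set S), IsOpen N → ∀ σ : 𝒱.Sec, 𝒱.IsSmoothOn E σ N →
    (∀ s ∈ N, σ s ∈ 𝒱.U p s) → ∀ s ∈ N, ∀ ξ : E, 𝒱.nabla10 σ s ξ - θ s ξ (σ s) ∈ 𝒱.U p s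

end VGPMHS

end MixedHodge

end

/-!
The Deligne bigrading is constructed one weight at a time: with `C` the sum of `conj F^q` and all
`I^{r,s}` with `r < p`, `s < q`, the space `I^{p,q} = F^p ∩ W_{p+q} ∩ C` lifts the Hodge
`(p, q)`-component of `Gr^W_{p+q}`. This description as an intersection makes `dim I^{p,q}` upper
semicontinuous along the base; as the dimensions add up to a constant, every `I^{p,q}` has constant
rank, and a smooth moving frame carries the bigrading at `s₀` to the bigrading at nearby points.

Differentiating such a frame gives a connection form. Holomorphy of `F`, horizontality, flatness of
`W` and reality constrain its `(0,1)`- and `(1,0)`-parts: modulo endomorphisms preserving the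
`𝒰^p`, the former shifts `p` by `1` and the latter by `-1`. These shifts are `τ` and `θ`. Since `∇`
is real, the `(0,1)`-part is conjugate to the `(1,0)`-part up to terms that lower the weight, whence
`τ = (conj θ)^Y`. Finally, a smooth frame of `𝒰^p` whose image under a fixed projection `π`,
injective on `𝒰^p`, is constant satisfies `π ∇e = 0`; if `τ` vanishes on `𝒰^p`, then `∇^{0,1} e`
lies in `𝒰^p`, so it is zero and the frame is holomorphic.
-/

noncomputable section

namespace MixedHodge

section SumOver

variable {R X ι : Type*} [Ring R] [AddCommGroup X] [Module R X]

/-- The sum of the subspaces `I i` over the indices `i ∈ A`. -/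
def sumOver (I : ι → Submodule R X) (A : Set ι) : Submodule R X := ⨆ i ∈ A, I i

variable {I J : ι → Submodule R X} {A B : Set ι}

theorem le_sumOver {i : ι} (hi : i ∈ A) : I i ≤ sumOver I A :=
  le_iSup₂_of_le i hi le_rfl

theorem sumOver_le {P : Submodule R X} (h : ∀ i ∈ A, I i ≤ P) : sumOver I A ≤ P :=
  iSup₂_le h

theorem sumOver_mono (h : A ⊆ B) : sumOver I A ≤ sumOver I B :=
  biSup_mono h

theorem sumOver_mono_left (h : ∀ i ∈ A, I i ≤ J i) : sumOver I A ≤ sumOver J A :=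
  iSup₂_mono h

theorem sumOver_congr (h : ∀ i ∈ A, I i = J i) : sumOver I A = sumOver J A :=
  biSup_congr h

theorem sumOver_union : sumOver I (A ∪ B) = sumOver I A ⊔ sumOver I B :=
  iSup_union

theorem sumOver_insert (i : ι) : sumOver I (insert i A) = I i ⊔ sumOver I A :=
  iSup_insert

theorem sumOver_singleton (i : ι) : sumOver I {i} = I i :=
  iSup_singleton

theorem disjoint_sumOver (h : iSupIndep I) (hAB : Disjoint A B) :
    Disjoint (sumOver I A) (sumOver I B) :=
  h.disjoint_biSup_biSup hAB

theorem sumOver_inf_sumOver (h : iSupIndep I) (A B : Set ι) :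
    sumOver I A ⊓ sumOver I B = sumOver I (A ∩ B) := by
  have hB : sumOver I B = sumOver I (A ∩ B) ⊔ sumOver I (B \ A) := by
    rw [← sumOver_union, Set.inter_comm, Set.inter_union_sdiff]
  have hd : Disjoint (sumOver I (B \ A)) (sumOver I A) :=
    disjoint_sumOver h Set.disjoint_sdiff_left
  rw [hB, inf_comm, sup_inf_assoc_of_le _ (sumOver_mono Set.inter_subset_left), hd.eq_bot,
    sup_bot_eq]

theorem iSupIndep_of_disjoint_biSup_lt {κ : Type*} [LinearOrder κ] {f : ι → κ}
    (hf : Function.Injective f) (h : ∀ i, Disjoint (I i) (sumOver I {j | f j < f i})) :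
    iSupIndep I := by
  classical
  rw [iSupIndep_iff_finsetSum_eq_zero_imp_eq_zero]
  intro s v hv hsum
  by_contra! hne
  obtain ⟨i, hi, hmax⟩ := (s.filter (v · ≠ 0)).exists_max_image f
    (hne.imp fun i hi => Finset.mem_filter.2 hi)
  obtain ⟨his, hvi⟩ := Finset.mem_filter.1 hi
  have hrest : ∑ j ∈ s.erase i, v j ∈ sumOver I {j | f j < f i} := by
    refine Submodule.sum_mem _ fun j hj => ?_
    obtain ⟨hji, hjs⟩ := Finset.mem_erase.1 hj
    by_cases hvj : v j = 0
    · exact hvj ▸ Submodule.zero_mem _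
    · have hlt : f j < f i :=
        (hmax j (Finset.mem_filter.2 ⟨hjs, hvj⟩)).lt_of_ne (hf.ne hji)
      exact le_sumOver (A := {j | f j < f i}) hlt (hv j hjs)
  rw [← Finset.add_sum_erase _ _ his] at hsum
  refine hvi (Submodule.disjoint_def.1 (h i) _ (hv i his) ?_)
  rw [eq_neg_of_add_eq_zero_left hsum]
  exact Submodule.neg_mem _ hrest

end SumOver

section Bigrading

/-- The indices `(r, s)` with `r < p` and `s < q`. -/
def below (p q : ℤ) : Set (ℤ × ℤ) := Set.Iio p ×ˢ Set.Iio q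

theorem mem_below {p q : ℤ} {i : ℤ × ℤ} : i ∈ below p q ↔ i.1 < p ∧ i.2 < q :=
  Iff.rfl

variable {R X : Type*} [Ring R] [AddCommGroup X] [Module R X] {ν : R →+* R}

/-- The conditions that define Deligne's bigrading `I` of `(F, W)`, relative to the conjugation
`c`, except that the sum of the `I^{p,q}` may be a proper subspace. Since `c` is an involution,
the conjugate of a subspace `P` is `P.comap c`. -/
structure IsBigrading (c : X →ₛₗ[ν] X) (W F : ℤ → Submodule R X)
    (I : ℤ × ℤ → Submodule R X) : Prop where
  involutive : Function.Involutive c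
  indep : iSupIndep I
  F_eq : ∀ p, F p = sumOver I {i | p ≤ i.1}
  W_eq : ∀ k, W k = sumOver I {i | i.1 + i.2 ≤ k}
  exists_W_eq_bot : ∃ k, W k = ⊥
  le_comap : ∀ p q, I (p, q) ≤ (sumOver I (insert (q, p) (below q p))).comap c

namespace IsBigrading

variable {c : X →ₛₗ[ν] X} {W F : ℤ → Submodule R X} {I : ℤ × ℤ → Submodule R X}
  {A B : Set (ℤ × ℤ)}

theorem sumOver_le_comap (h : IsBigrading c W F I)
    (hAB : ∀ p q, (p, q) ∈ A → insert (q, p) (below q p) ⊆ B) :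
    sumOver I A ≤ (sumOver I B).comap c :=
  sumOver_le fun i hi =>
    (h.le_comap i.1 i.2).trans (Submodule.comap_mono (sumOver_mono (hAB i.1 i.2 hi)))

theorem W_le_comap (h : IsBigrading c W F I) (k : ℤ) : W k ≤ (W k).comap c := by
  rw [h.W_eq]
  exact h.sumOver_le_comap fun p q hpq => by grind [below]

theorem sumOver_below_le_comap (h : IsBigrading c W F I) (p q : ℤ) :
    sumOver I (below p q) ≤ (sumOver I (below q p)).comap c :=
  h.sumOver_le_comap fun p q hpq => by grind [below]

theorem conj_mod (h : IsBigrading c W F I) (p q : ℤ) :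
    I (p, q) ⊔ sumOver I (below p q) = (I (q, p)).comap c ⊔ sumOver I (below p q) := by
  refine le_antisymm (sup_le (fun x hx => ?_) le_sup_right) (sup_le (fun x hx => ?_) le_sup_right)
  · have hcx := h.le_comap p q hx
    rw [Submodule.mem_comap, sumOver_insert] at hcx
    obtain ⟨y, hy, z, hz, hyz⟩ := Submodule.mem_sup.1 hcx
    rw [← h.involutive x, ← hyz, map_add]
    exact Submodule.add_mem_sup (by rwa [Submodule.mem_comap, h.involutive])
      (h.sumOver_below_le_comap q p hz)
  · rw [← sumOver_insert, ← h.involutive x]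
    exact h.le_comap q p hx

theorem F_antitone (h : IsBigrading c W F I) : Antitone F := fun p q hpq => by
  rw [h.F_eq, h.F_eq]
  exact sumOver_mono fun i hi => hpq.trans hi

theorem le_F (h : IsBigrading c W F I) (p q : ℤ) : I (p, q) ≤ F p := by
  rw [h.F_eq]
  exact le_sumOver (le_refl p)

theorem le_W (h : IsBigrading c W F I) (p q : ℤ) : I (p, q) ≤ W (p + q) := by
  rw [h.W_eq]
  exact le_sumOver (le_refl (p + q))

theorem sumOver_below_le_W (h : IsBigrading c W F I) {p q k : ℤ} (hk : p + q ≤ k + 2) :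
    sumOver I (below p q) ≤ W k := by
  rw [h.W_eq]
  exact sumOver_mono (by grind [below])

theorem le_conj_F_sup (h : IsBigrading c W F I) (p q : ℤ) :
    I (p, q) ≤ (F q).comap c ⊔ sumOver I (below p q) :=
  le_sup_left.trans ((h.conj_mod p q).le.trans
    (sup_le_sup_right (Submodule.comap_mono (h.le_F q p)) _))

theorem le_conj_F_sup_of_lt (h : IsBigrading c W F I) {p r : ℤ} (hr : r < p) (q s : ℤ) :
    I (r, s) ≤ (F q).comap c ⊔ sumOver I (below p q) := by
  by_cases hs : s < q
  · exact le_sup_of_le_right (le_sumOver ⟨hr, hs⟩)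
  · refine (h.le_conj_F_sup r s).trans (sup_le ?_ (sumOver_le fun i hi => ?_))
    · exact le_sup_of_le_left (Submodule.comap_mono (h.F_antitone (not_lt.1 hs)))
    · exact h.le_conj_F_sup_of_lt (hi.1.trans hr) q i.2
termination_by (s - q + 1).toNat
decreasing_by have := hi.2; simp only [Set.mem_Iio] at this; omega

theorem sumOver_univ_le (h : IsBigrading c W F I) (p q : ℤ) :
    sumOver I Set.univ ≤ F p ⊔ ((F q).comap c ⊔ sumOver I (below p q)) := by
  refine sumOver_le fun i _ => ?_
  rcases le_or_gt p i.1 with hp | hp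
  · exact le_sup_of_le_left ((h.le_F i.1 i.2).trans (h.F_antitone hp))
  · exact le_sup_of_le_right (h.le_conj_F_sup_of_lt hp q i.2)

theorem conj_F_inf_W_le (h : IsBigrading c W F I) (q k : ℤ) :
    (F q).comap c ⊓ W k ≤ sumOver I (insert (k - q, q) {i | i.1 < k - q}) := by
  rintro x ⟨hF, hW⟩
  have hcx : c x ∈ sumOver I ({i | q ≤ i.1} ∩ {i | i.1 + i.2 ≤ k}) := by
    rw [← sumOver_inf_sumOver h.indep, ← h.F_eq, ← h.W_eq]
    exact ⟨hF, h.W_le_comap k hW⟩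
  rw [← h.involutive x]
  exact h.sumOver_le_comap (fun r s hrs => by grind -funext [below]) hcx

theorem W_inf_conj_F_sup_le (h : IsBigrading c W F I) {p q k : ℤ} (hk : k ≤ p + q)
    (hk' : p + q ≤ k + 2) :
    W k ⊓ ((F q).comap c ⊔ sumOver I (below p q)) ≤
      sumOver I (insert (k - q, q) {i | i.1 < p}) := by
  rw [inf_comm, sup_comm, sup_inf_assoc_of_le _ (h.sumOver_below_le_W hk')]
  exact sup_le (sumOver_mono (by grind [below]))
    ((h.conj_F_inf_W_le q k).trans (sumOver_mono (by grind)))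

theorem F_inf_W_inf_conj_F_sup_eq_bot (h : IsBigrading c W F I) {p q k : ℤ}
    (hk : k + 1 = p + q) : F p ⊓ (W k ⊓ ((F q).comap c ⊔ sumOver I (below p q))) = ⊥ := by
  rw [eq_bot_iff]
  refine (inf_le_inf_left _ (h.W_inf_conj_F_sup_le (by omega) (by omega))).trans ?_
  rw [h.F_eq, sumOver_inf_sumOver h.indep]
  exact sumOver_le fun i hi => by grind

theorem disjoint_conj_F_below (h : IsBigrading c W F I) (p q : ℤ) :
    Disjoint ((F q).comap c) (sumOver I (below p q)) := by
  rw [Submodule.disjoint_def]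
  intro x hF hx
  rw [Submodule.mem_comap, h.F_eq] at hF
  have hdisj : Disjoint {i : ℤ × ℤ | q ≤ i.1} (below q p) :=
    Set.disjoint_left.2 (by grind [below])
  have hcx : c x = 0 := Submodule.disjoint_def.1 (disjoint_sumOver h.indep hdisj) _ hF
    (h.sumOver_below_le_comap p q hx)
  rw [← h.involutive x, hcx, map_zero]

end IsBigrading

/-- The intersection `F^p ∩ W_{p+q} ∩ (conj F^q + ⨁_{r<p, s<q} J^{r,s})`, which is Deligne's
`I^{p,q}` when `J` is the bigrading in lower weights. -/
def delignePiece (c : X →ₛₗ[ν] X) (W F : ℤ → Submodule R X) (J : ℤ × ℤ → Submodule R X)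
    (p q : ℤ) : Submodule R X :=
  F p ⊓ (W (p + q) ⊓ ((F q).comap c ⊔ sumOver J (below p q)))

theorem IsBigrading.eq_delignePiece {c : X →ₛₗ[ν] X} {W F : ℤ → Submodule R X}
    {I : ℤ × ℤ → Submodule R X} (h : IsBigrading c W F I) (p q : ℤ) :
    I (p, q) = delignePiece c W F I p q := by
  refine le_antisymm (le_inf (h.le_F p q) (le_inf (h.le_W p q) (h.le_conj_F_sup p q))) ?_
  refine (inf_le_inf_left _ (h.W_inf_conj_F_sup_le le_rfl (by omega))).trans ?_
  rw [h.F_eq, sumOver_inf_sumOver h.indep]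
  refine sumOver_le fun i hi => le_of_eq ?_
  congr 1
  grind

end Bigrading

section Existence

variable {R X : Type*} [Ring R] [AddCommGroup X] [Module R X] {ν : R →+* R}

/-- The preimage in `W_k` of the subspace of `W_k / W_{k-1}` induced by `P`. -/
def grLift (W : ℤ → Submodule R X) (k : ℤ) (P : Submodule R X) : Submodule R X :=
  P ⊓ W k ⊔ W (k - 1)

theorem grLift_mono {W : ℤ → Submodule R X} {k : ℤ} {P P' : Submodule R X} (h : P ≤ P') :
    grLift W k P ≤ grLift W k P' :=
  sup_le_sup_right (inf_le_inf_right _ h) _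

/-- `W` and `F` are finite filtrations such that the filtrations induced on `W_k / W_{k-1}` by
`F` and its conjugate are `k`-opposed. This is the notion of a mixed Hodge structure without
reference to a rational structure. -/
structure IsOpposed (c : X →ₛₗ[ν] X) (W F : ℤ → Submodule R X) : Prop where
  involutive : Function.Involutive c
  monotone_W : Monotone W
  exists_W_eq_bot : ∃ a, W a = ⊥
  exists_W_eq_top : ∃ b, W b = ⊤
  antitone_F : Antitone F
  exists_F_eq_top : ∃ a, F a = ⊤
  exists_F_eq_bot : ∃ b, F b = ⊥
  W_le_comap : ∀ k, W k ≤ (W k).comap c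
  W_le : ∀ k p q, p + q = k + 1 → W k ≤ grLift W k (F p) ⊔ grLift W k ((F q).comap c)
  inf_le : ∀ k p q, p + q = k + 1 → grLift W k (F p) ⊓ grLift W k ((F q).comap c) ≤ W (k - 1)

/-- `J` is a bigrading of `W_k`, with the filtrations that `W` and `F` induce on it. -/
def IsBigradingUpTo (c : X →ₛₗ[ν] X) (W F : ℤ → Submodule R X) (k : ℤ)
    (J : ℤ × ℤ → Submodule R X) : Prop :=
  IsBigrading c (fun j => W (min j k)) (fun p => F p ⊓ W k) J

/-- The bigrading of `W_k` made from the bigrading `J` of `W_{k-1}`. -/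
def bigradingExtend (c : X →ₛₗ[ν] X) (W F : ℤ → Submodule R X) (k : ℤ)
    (J : ℤ × ℤ → Submodule R X) (i : ℤ × ℤ) : Submodule R X :=
  if i.1 + i.2 = k then delignePiece c W F J i.1 i.2 else J i

variable {c : X →ₛₗ[ν] X} {W F : ℤ → Submodule R X} {J : ℤ × ℤ → Submodule R X} {k : ℤ}

theorem bigradingExtend_of_eq {i : ℤ × ℤ} (hi : i.1 + i.2 = k) :
    bigradingExtend c W F k J i = delignePiece c W F J i.1 i.2 :=
  if_pos hi

theorem bigradingExtend_of_ne {i : ℤ × ℤ} (hi : i.1 + i.2 ≠ k) :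
    bigradingExtend c W F k J i = J i :=
  if_neg hi

theorem sumOver_bigradingExtend {A : Set (ℤ × ℤ)} (hA : ∀ i ∈ A, i.1 + i.2 ≠ k) :
    sumOver (bigradingExtend c W F k J) A = sumOver J A :=
  sumOver_congr fun i hi => bigradingExtend_of_ne (hA i hi)

namespace IsBigradingUpTo

theorem W_eq_sumOver (h : IsBigradingUpTo c W F k J) : W k = sumOver J {i | i.1 + i.2 ≤ k} := by
  have hW := h.W_eq k
  rwa [min_self] at hW

theorem eq_bot (h : IsBigradingUpTo c W F k J) {i : ℤ × ℤ} (hi : k < i.1 + i.2) : J i = ⊥ := by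
  have hle : J i ≤ W k := (h.le_W i.1 i.2).trans_eq (congrArg W (min_eq_right hi.le))
  have hdisj : Disjoint (sumOver J {i}) (sumOver J {j | j.1 + j.2 ≤ k}) :=
    disjoint_sumOver h.indep (Set.disjoint_singleton_left.2 (not_le.2 hi))
  rw [sumOver_singleton, ← h.W_eq_sumOver] at hdisj
  exact hdisj.eq_bot_of_le hle

theorem piece_le_W (h : IsBigradingUpTo c W F k J) (i : ℤ × ℤ) : J i ≤ W k := by
  by_cases hi : i.1 + i.2 ≤ k
  · exact h.W_eq_sumOver ▸ le_sumOver hi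
  · exact (h.eq_bot (not_le.1 hi)).trans_le bot_le

theorem sumOver_le_W (h : IsBigradingUpTo c W F k J) (A : Set (ℤ × ℤ)) : sumOver J A ≤ W k :=
  sumOver_le fun i _ => h.piece_le_W i

theorem le_bigradingExtend (h : IsBigradingUpTo c W F (k - 1) J) (i : ℤ × ℤ) :
    J i ≤ bigradingExtend c W F k J i := by
  by_cases hi : i.1 + i.2 = k
  · exact (h.eq_bot (by omega)).trans_le bot_le
  · exact (bigradingExtend_of_ne hi).ge

theorem bigradingExtend_eq_bot (h : IsBigradingUpTo c W F (k - 1) J) {i : ℤ × ℤ}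
    (hi : k < i.1 + i.2) : bigradingExtend c W F k J i = ⊥ :=
  (bigradingExtend_of_ne hi.ne').trans (h.eq_bot (by omega))

end IsBigradingUpTo

namespace IsOpposed

theorem delignePiece_inf_W (hO : IsOpposed c W F) (hJ : IsBigradingUpTo c W F (k - 1) J)
    {p q : ℤ} (hpq : p + q = k) : delignePiece c W F J p q ⊓ W (k - 1) = ⊥ := by
  rw [eq_bot_iff, ← hJ.F_inf_W_inf_conj_F_sup_eq_bot (p := p) (q := q) (k := k - 1) (by omega)]
  rintro v ⟨⟨hF, -, hv⟩, hW⟩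
  refine ⟨⟨hF, hW⟩, by simpa only [min_self] using hW, ?_⟩
  obtain ⟨z, hz, l, hl, rfl⟩ := Submodule.mem_sup.1 hv
  have hzW : z ∈ W (k - 1) := by simpa using Submodule.sub_mem _ hW (hJ.sumOver_le_W _ hl)
  exact Submodule.add_mem_sup ⟨hz, hO.W_le_comap _ hzW⟩ hl

theorem grLift_inf_grLift_le (hO : IsOpposed c W F) (hJ : IsBigradingUpTo c W F (k - 1) J)
    {p q : ℤ} (hpq : p + q = k) :
    grLift W k (F p) ⊓ grLift W k ((F q).comap c) ≤ delignePiece c W F J p q ⊔ W (k - 1) := by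
  rintro v ⟨hvF, hvF'⟩
  obtain ⟨x, ⟨hxF, hxW⟩, w, hw, rfl⟩ := Submodule.mem_sup.1 hvF
  obtain ⟨z, ⟨hzF, -⟩, w', hw', hz⟩ := Submodule.mem_sup.1 hvF'
  have hdiff : x - z ∈ W (k - 1) := by
    rw [(sub_eq_sub_iff_add_eq_add.2 (by rw [← hz, add_comm]) : x - z = w' - w)]
    exact Submodule.sub_mem _ hw' hw
  -- `x - z` splits as `x' + (z' + l)`, and `x - x' = z + z' + l` is the wanted element.
  rw [hJ.W_eq_sumOver] at hdiff
  obtain ⟨x', hx', y, hy, hxy⟩ :=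
    Submodule.mem_sup.1 (hJ.sumOver_univ_le p q (sumOver_mono (Set.subset_univ _) hdiff))
  obtain ⟨z', hz', l, hl, rfl⟩ := Submodule.mem_sup.1 hy
  have hpiece : x - x' ∈ delignePiece c W F J p q := by
    refine ⟨Submodule.sub_mem _ hxF hx'.1, ?_, ?_⟩
    · rw [hpq]
      exact Submodule.sub_mem _ hxW (hO.monotone_W (by omega) hx'.2)
    · rw [show x - x' = z + z' + l by
        rw [sub_eq_iff_eq_add, sub_eq_iff_eq_add'.1 hxy.symm]; abel]
      exact Submodule.add_mem_sup (Submodule.add_mem _ hzF hz'.1) hl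
  rw [show x + w = (x - x') + (x' + w) by abel]
  exact Submodule.add_mem_sup hpiece (Submodule.add_mem _ hx'.2 hw)

theorem delignePiece_le_grLift_F {p q : ℤ} (hpq : p + q = k) :
    delignePiece c W F J p q ≤ grLift W k (F p) :=
  le_sup_of_le_left (inf_le_inf_left _ (hpq ▸ inf_le_left))

theorem delignePiece_le_grLift_conj_F (hO : IsOpposed c W F)
    (hJ : IsBigradingUpTo c W F (k - 1) J) {p q : ℤ} (hpq : p + q = k) :
    delignePiece c W F J p q ≤ grLift W k ((F q).comap c) := by
  rintro v ⟨-, hW, hv⟩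
  obtain ⟨z, hz, l, hl, rfl⟩ := Submodule.mem_sup.1 hv
  have hlW := hJ.sumOver_le_W _ hl
  rw [hpq] at hW
  have hzW : z ∈ W k :=
    (Submodule.add_mem_iff_left _ (hO.monotone_W (sub_le_self k zero_le_one) hlW)).1 hW
  exact Submodule.add_mem_sup ⟨hz, hzW⟩ hlW

theorem disjoint_delignePiece (hO : IsOpposed c W F) (hJ : IsBigradingUpTo c W F (k - 1) J)
    {p q : ℤ} (hpq : p + q = k) :
    Disjoint (delignePiece c W F J p q) (grLift W k ((F (q + 1)).comap c)) := by
  rw [disjoint_iff_inf_le, ← hO.delignePiece_inf_W hJ hpq]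
  exact le_inf inf_le_left ((inf_le_inf_right _ (delignePiece_le_grLift_F hpq)).trans
    (hO.inf_le k p (q + 1) (by omega)))

-- Descending induction on `p`: on `W_k / W_{k-1}`, `F^p` is the sum of `F^{p+1}` and the image of
-- the single piece `(p, k - p)`.
theorem grLift_F_le (hO : IsOpposed c W F) (hJ : IsBigradingUpTo c W F (k - 1) J) {b : ℤ}
    (hb : F b = ⊥) (p : ℤ) :
    grLift W k (F p) ≤
      sumOver (bigradingExtend c W F k J) {i | p ≤ i.1 ∧ i.1 + i.2 = k} ⊔ W (k - 1) := by
  by_cases hp : b ≤ p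
  · have hFp : F p = ⊥ := eq_bot_iff.2 (hb ▸ hO.antitone_F hp)
    rw [grLift, hFp, bot_inf_eq]
    exact sup_le_sup_right bot_le _
  have hle : grLift W k (F (p + 1)) ≤ grLift W k (F p) := grLift_mono (hO.antitone_F (by omega))
  have hW : grLift W k (F p) ≤ W k := sup_le inf_le_right (hO.monotone_W (by omega))
  have hsplit : grLift W k (F p) ≤ grLift W k (F (p + 1)) ⊔
      grLift W k ((F (k - p)).comap c) ⊓ grLift W k (F p) := by
    rw [← sup_inf_assoc_of_le _ hle]
    exact le_inf (hW.trans (hO.W_le k (p + 1) (k - p) (by omega))) le_rfl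
  refine hsplit.trans (sup_le ?_ ?_)
  · exact (hO.grLift_F_le hJ hb (p + 1)).trans (sup_le_sup_right
      (sumOver_mono (by grind)) _)
  · rw [inf_comm]
    refine (hO.grLift_inf_grLift_le hJ (add_sub_cancel p k)).trans (sup_le_sup_right ?_ _)
    rw [← bigradingExtend_of_eq (i := (p, k - p)) (add_sub_cancel p k)]
    exact le_sumOver ⟨le_rfl, add_sub_cancel p k⟩
termination_by (b - p).toNat

theorem bigradingExtend_le_W (hO : IsOpposed c W F) (hJ : IsBigradingUpTo c W F (k - 1) J)
    (i : ℤ × ℤ) : bigradingExtend c W F k J i ≤ W k := by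
  by_cases hi : i.1 + i.2 = k
  · rw [bigradingExtend_of_eq hi, delignePiece, hi]
    exact inf_le_right.trans inf_le_left
  · rw [bigradingExtend_of_ne hi]
    exact (hJ.piece_le_W i).trans (hO.monotone_W (by omega))

theorem bigradingExtend_le_F (hO : IsOpposed c W F) (hJ : IsBigradingUpTo c W F (k - 1) J)
    {p : ℤ} {i : ℤ × ℤ} (hi : p ≤ i.1) : bigradingExtend c W F k J i ≤ F p := by
  by_cases hk : i.1 + i.2 = k
  · rw [bigradingExtend_of_eq hk]
    exact inf_le_left.trans (hO.antitone_F hi)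
  · rw [bigradingExtend_of_ne hk]
    exact (hJ.le_F i.1 i.2).trans (inf_le_left.trans (hO.antitone_F hi))

theorem bigradingExtend_le_grLift_conj_F (hO : IsOpposed c W F)
    (hJ : IsBigradingUpTo c W F (k - 1) J) {q : ℤ} {i : ℤ × ℤ} (hi : i.1 + i.2 = k → q ≤ i.2) :
    bigradingExtend c W F k J i ≤ grLift W k ((F q).comap c) := by
  by_cases hk : i.1 + i.2 = k
  · rw [bigradingExtend_of_eq hk]
    exact (hO.delignePiece_le_grLift_conj_F hJ hk).trans
      (grLift_mono (Submodule.comap_mono (hO.antitone_F (hi hk))))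
  · rw [bigradingExtend_of_ne hk]
    exact le_sup_of_le_right (hJ.piece_le_W i)

-- Order the indices by weight and then by `p`; within the new weight, all earlier pieces lie in
-- the conjugate of `F^{q+1}` modulo lower weight.
theorem iSupIndep_bigradingExtend (hO : IsOpposed c W F)
    (hJ : IsBigradingUpTo c W F (k - 1) J) : iSupIndep (bigradingExtend c W F k J) := by
  refine iSupIndep_of_disjoint_biSup_lt (f := fun i : ℤ × ℤ => toLex (i.1 + i.2, i.1)) ?_ ?_
  · rintro ⟨p, q⟩ ⟨p', q'⟩ h
    obtain ⟨hsum, hp⟩ := Prod.mk.inj (toLex.injective h)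
    exact Prod.ext hp (by simp only at hsum hp ⊢; omega)
  · rintro ⟨p, q⟩
    simp only [Prod.Lex.toLex_lt_toLex]
    rcases lt_trichotomy (p + q) k with hk | hk | hk
    · rw [sumOver_bigradingExtend (by grind), bigradingExtend_of_ne hk.ne,
        ← sumOver_singleton (I := J)]
      exact disjoint_sumOver hJ.indep (Set.disjoint_singleton_left.2 (by simp))
    · rw [bigradingExtend_of_eq hk]
      refine (hO.disjoint_delignePiece hJ hk).mono_right (sumOver_le fun i hi => ?_)
      exact hO.bigradingExtend_le_grLift_conj_F hJ (by grind)
    · rw [hJ.bigradingExtend_eq_bot hk]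
      exact disjoint_bot_left

theorem F_inf_W_eq_sumOver (hO : IsOpposed c W F) (hJ : IsBigradingUpTo c W F (k - 1) J)
    (p : ℤ) : F p ⊓ W k = sumOver (bigradingExtend c W F k J) {i | p ≤ i.1} := by
  obtain ⟨b, hb⟩ := hO.exists_F_eq_bot
  refine le_antisymm ?_ (sumOver_le fun i hi =>
    le_inf (hO.bigradingExtend_le_F hJ hi) (hO.bigradingExtend_le_W hJ i))
  have hle : F p ⊓ W k ≤
      (sumOver (bigradingExtend c W F k J) {i | p ≤ i.1 ∧ i.1 + i.2 = k} ⊔ W (k - 1)) ⊓ F p :=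
    le_inf (le_sup_left.trans (hO.grLift_F_le hJ hb p)) inf_le_left
  rw [sup_inf_assoc_of_le _ (sumOver_le fun i hi => hO.bigradingExtend_le_F hJ hi.1),
    inf_comm (W _), hJ.F_eq] at hle
  exact hle.trans (sup_le (sumOver_mono fun i hi => hi.1)
    (sumOver_mono_left fun i _ => hJ.le_bigradingExtend i))

theorem W_min_eq_sumOver (hO : IsOpposed c W F) (hJ : IsBigradingUpTo c W F (k - 1) J)
    (j : ℤ) : W (min j k) = sumOver (bigradingExtend c W F k J) {i | i.1 + i.2 ≤ j} := by
  by_cases hj : j < k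
  · rw [sumOver_bigradingExtend (A := {i | i.1 + i.2 ≤ j}) (by grind), ← hJ.W_eq]
    congr 1
    omega
  · rw [min_eq_right (not_lt.1 hj)]
    refine le_antisymm ?_ (sumOver_le fun i _ => hO.bigradingExtend_le_W hJ i)
    obtain ⟨a, ha⟩ := hO.exists_F_eq_top
    rw [← top_inf_eq (W k), ← ha, hO.F_inf_W_eq_sumOver hJ]
    refine sumOver_le fun i _ => ?_
    by_cases hi : i.1 + i.2 ≤ k
    · exact le_sumOver (hi.trans (not_lt.1 hj))
    · exact (hJ.bigradingExtend_eq_bot (not_le.1 hi)).trans_le bot_le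

theorem delignePiece_le_comap (hO : IsOpposed c W F) (hJ : IsBigradingUpTo c W F (k - 1) J)
    {p q : ℤ} (hpq : p + q = k) :
    delignePiece c W F J p q ≤ (delignePiece c W F J q p ⊔ sumOver J (below q p)).comap c := by
  rintro v ⟨hF, hW, hv⟩
  obtain ⟨z, hz, l, hl, rfl⟩ := Submodule.mem_sup.1 hv
  have hcl : c l ∈ sumOver J (below q p) := hJ.sumOver_below_le_comap p q hl
  have hclW : c l ∈ W (q + p) :=
    hO.monotone_W (by omega) (hJ.sumOver_le_W _ hcl)
  have hcW : c z + c l ∈ W (q + p) := by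
    rw [← map_add, add_comm q]
    exact hO.W_le_comap _ hW
  rw [Submodule.mem_comap, map_add]
  refine Submodule.add_mem_sup ⟨hz, (Submodule.add_mem_iff_left _ hclW).1 hcW, ?_⟩ hcl
  rw [← add_sub_cancel_right (c z) (c l)]
  refine Submodule.sub_mem _ (Submodule.mem_sup_left ?_) (Submodule.mem_sup_right hcl)
  rwa [Submodule.mem_comap, ← map_add, hO.involutive]

theorem bigradingExtend_le_comap (hO : IsOpposed c W F)
    (hJ : IsBigradingUpTo c W F (k - 1) J) (p q : ℤ) :
    bigradingExtend c W F k J (p, q) ≤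
      (sumOver (bigradingExtend c W F k J) (insert (q, p) (below q p))).comap c := by
  rcases lt_trichotomy (p + q) k with hk | hk | hk
  · rw [sumOver_bigradingExtend (by grind [below]), bigradingExtend_of_ne hk.ne]
    exact hJ.le_comap p q
  · rw [sumOver_insert, bigradingExtend_of_eq (i := (p, q)) hk,
      bigradingExtend_of_eq (i := (q, p)) ((add_comm q p).trans hk),
      sumOver_bigradingExtend (by grind [below])]
    exact hO.delignePiece_le_comap hJ hk
  · exact (hJ.bigradingExtend_eq_bot hk).trans_le bot_le

theorem isBigradingUpTo_extend (hO : IsOpposed c W F) (hJ : IsBigradingUpTo c W F (k - 1) J) :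
    IsBigradingUpTo c W F k (bigradingExtend c W F k J) where
  involutive := hO.involutive
  indep := hO.iSupIndep_bigradingExtend hJ
  F_eq := hO.F_inf_W_eq_sumOver hJ
  W_eq := hO.W_min_eq_sumOver hJ
  exists_W_eq_bot := hO.exists_W_eq_bot.imp fun a ha =>
    eq_bot_iff.2 ((hO.monotone_W (min_le_left a k)).trans_eq ha)
  le_comap := hO.bigradingExtend_le_comap hJ

theorem isBigradingUpTo_bot (hO : IsOpposed c W F) (hk : W k = ⊥) :
    IsBigradingUpTo c W F k ⊥ := by
  have hbot (A : Set (ℤ × ℤ)) : sumOver (⊥ : ℤ × ℤ → Submodule R X) A = ⊥ :=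
    eq_bot_iff.2 (sumOver_le fun _ _ => le_rfl)
  have hW (j : ℤ) : W (min j k) = ⊥ :=
    eq_bot_iff.2 ((hO.monotone_W (min_le_right j k)).trans_eq hk)
  refine ⟨hO.involutive, fun i => disjoint_bot_left, fun p => ?_, fun j => ?_, ⟨k, hW k⟩,
    fun p q => bot_le⟩
  · rw [hbot, hk, inf_bot_eq]
  · rw [hbot, hW]

theorem exists_isBigradingUpTo (hO : IsOpposed c W F) (k : ℤ) :
    ∃ J, IsBigradingUpTo c W F k J := by
  obtain ⟨a, ha⟩ := hO.exists_W_eq_bot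
  induction k using Int.inductionOn' (b := a) with
  | zero => exact ⟨⊥, hO.isBigradingUpTo_bot ha⟩
  | succ k _ ih =>
    obtain ⟨J, hJ⟩ := ih
    exact ⟨_, hO.isBigradingUpTo_extend (k := k + 1) (by rwa [add_sub_cancel_right])⟩
  | pred k hk _ =>
    exact ⟨⊥, hO.isBigradingUpTo_bot (eq_bot_iff.2 (ha ▸ hO.monotone_W (by omega)))⟩

theorem exists_isBigrading (hO : IsOpposed c W F) :
    ∃ I, IsBigrading c W F I ∧ ⨆ i, I i = ⊤ := by
  obtain ⟨b, hb⟩ := hO.exists_W_eq_top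
  obtain ⟨J, hJ⟩ := hO.exists_isBigradingUpTo b
  have hW (k : ℤ) : W (min k b) = W k := by
    rcases le_total k b with hk | hk
    · rw [min_eq_left hk]
    · rw [min_eq_right hk, hb, eq_comm, eq_top_iff, ← hb]
      exact hO.monotone_W hk
  have hF (p : ℤ) : F p ⊓ W b = F p := by rw [hb, inf_top_eq]
  refine ⟨J, by simpa only [IsBigradingUpTo, hW, hF] using hJ, ?_⟩
  rw [eq_top_iff, ← hb, hJ.W_eq_sumOver]
  exact sumOver_le fun i _ => le_iSup J i

end IsOpposed

end Existence

section MixedHodgeStructures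

variable {V V' : Type*} [AddCommGroup V] [Module ℚ V] [AddCommGroup V'] [Module ℚ V']

theorem map_baseChange {R A M N : Type*} [CommRing R] [CommRing A] [Algebra R A] [AddCommGroup M]
    [Module R M] [AddCommGroup N] [Module R N] (f : M →ₗ[R] N) (P : Submodule R M) :
    (P.map f).baseChange A = (P.baseChange A).map (f.baseChange A) := by
  rw [Submodule.baseChange_eq_span, Submodule.baseChange_eq_span, Submodule.map_span]
  congr 1
  ext x
  simp

theorem conj_conj (x : Cx V) : conj V (conj V x) = x := by
  induction x using TensorProduct.induction_on with
  | zero => simp only [map_zero]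
  | tmul z w => exact congrArg (· ⊗ₜ[ℚ] w) (star_star z)
  | add x y hx hy => rw [map_add, map_add, hx, hy]

theorem conj_baseChange (f : V →ₗ[ℚ] V') (x : Cx V) :
    conj V' (f.baseChange ℂ x) = f.baseChange ℂ (conj V x) := by
  induction x using TensorProduct.induction_on with
  | zero => simp only [map_zero]
  | tmul z w => rfl
  | add x y hx hy => rw [map_add, map_add, hx, hy, map_add, map_add]

theorem map_eq_comap_of_involutive {R X : Type*} [Ring R] [AddCommGroup X] [Module R X]
    {ν : R →+* R} [RingHomSurjective ν] {c : X →ₛₗ[ν] X} (hc : Function.Involutive c)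
    (P : Submodule R X) : P.map c = P.comap c :=
  SetLike.coe_injective
    (congrFun (Set.image_eq_preimage_of_inverse hc.leftInverse hc.rightInverse) P)

theorem conjSub_eq_comap (U : Submodule ℂ (Cx V)) : conjSub U = U.comap (conj V) :=
  map_eq_comap_of_involutive conj_conj U

theorem baseChange_le_comap_conj (P : Submodule ℚ V) :
    P.baseChange ℂ ≤ (P.baseChange ℂ).comap (conj V) := by
  rw [Submodule.baseChange]
  rintro _ ⟨y, rfl⟩
  exact ⟨conj _ y, (conj_baseChange _ _).symm⟩

theorem subtype_baseChange_injective (P : Submodule ℚ V) :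
    Function.Injective (P.subtype.baseChange ℂ) :=
  Module.Flat.lTensor_preserves_injective_linearMap (M := ℂ) P.subtype P.injective_subtype

theorem ker_mkQ_baseChange {P Q : Submodule ℚ V} (hPQ : P ≤ Q) :
    LinearMap.ker ((P.submoduleOf Q).mkQ.baseChange ℂ) =
      (P.baseChange ℂ).comap (Q.subtype.baseChange ℂ) := by
  have hker : LinearMap.ker ((P.submoduleOf Q).mkQ.baseChange ℂ) =
      (P.submoduleOf Q).baseChange ℂ :=
    SetLike.ext (lTensor_exact ℂ (LinearMap.exact_subtype_mkQ _) (Submodule.mkQ_surjective _))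
  have hP : (P.submoduleOf Q).map Q.subtype = P := by
    rw [Submodule.submoduleOf, Submodule.map_comap_subtype, inf_eq_right.2 hPQ]
  rw [hker, ← Submodule.comap_map_eq_of_injective
      (subtype_baseChange_injective Q) (Submodule.baseChange _ _),
    ← map_baseChange, hP]

variable {W : ℤ → Submodule ℚ V} {F : ℤ → Submodule ℂ (Cx V)}

theorem conjSub_grF (k p : ℤ) :
    conjSub (grF W F k p) = grF W (fun q => (F q).comap (conj V)) k p := by
  ext x
  constructor
  · rintro ⟨_, ⟨y, hy, rfl⟩, rfl⟩
    refine ⟨conj _ y, ?_, (conj_baseChange _ _).symm⟩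
    rwa [SetLike.mem_coe, Submodule.mem_comap, Submodule.mem_comap, conj_baseChange, conj_conj]
  · rintro ⟨y, hy, rfl⟩
    refine ⟨_, ⟨conj _ y, ?_, rfl⟩, by rw [conj_baseChange, conj_conj]⟩
    rwa [SetLike.mem_coe, Submodule.mem_comap, ← conj_baseChange]

/-- The preimage in `W_k` of a subspace of `Gr^W_k`, after complexification. -/
def grPreimage (W : ℤ → Submodule ℚ V) (k : ℤ) (P : Submodule ℂ (Cx (Gr W k))) :
    Submodule ℂ (Cx V) :=
  (P.comap (((W (k - 1)).submoduleOf (W k)).mkQ.baseChange ℂ)).map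
    ((W k).subtype.baseChange ℂ)

variable {k : ℤ}

theorem grPreimage_inf (P P' : Submodule ℂ (Cx (Gr W k))) :
    grPreimage W k (P ⊓ P') = grPreimage W k P ⊓ grPreimage W k P' := by
  rw [grPreimage, Submodule.comap_inf, Submodule.map_inf _ (subtype_baseChange_injective (W k)),
    grPreimage, grPreimage]

theorem grPreimage_sup_le (P P' : Submodule ℂ (Cx (Gr W k))) :
    grPreimage W k (P ⊔ P') ≤ grPreimage W k P ⊔ grPreimage W k P' := by
  have hsurj := LinearMap.baseChange_surjective ℂ
    (Submodule.mkQ_surjective ((W (k - 1)).submoduleOf (W k)))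
  rw [grPreimage, grPreimage, grPreimage, ← Submodule.map_sup]
  conv_lhs => rw [← Submodule.map_comap_eq_of_surjective hsurj P,
    ← Submodule.map_comap_eq_of_surjective hsurj P', ← Submodule.map_sup, Submodule.comap_map_eq]
  exact Submodule.map_mono (sup_le le_rfl (le_sup_of_le_left (LinearMap.ker_le_comap _)))

theorem grPreimage_top : grPreimage W k ⊤ = (W k).baseChange ℂ := by
  rw [grPreimage, Submodule.comap_top, Submodule.map_top, Submodule.baseChange]

theorem grPreimage_grF (hW : Monotone W) (p : ℤ) :
    grPreimage W k (grF W F k p) = grLift (fun k => (W k).baseChange ℂ) k (F p) := by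
  have hle : W (k - 1) ≤ W k := hW (sub_le_self k zero_le_one)
  rw [grPreimage, grF, Submodule.comap_map_eq, ker_mkQ_baseChange hle, Submodule.map_sup,
    Submodule.map_comap_eq, Submodule.map_comap_eq, ← Submodule.baseChange,
    inf_eq_right.2 (Submodule.baseChange_mono ℂ hle), inf_comm, grLift]

theorem grPreimage_bot (hW : Monotone W) :
    grPreimage W k ⊥ = (W (k - 1)).baseChange ℂ := by
  have hle : W (k - 1) ≤ W k := hW (sub_le_self k zero_le_one)
  rw [grPreimage, ← LinearMap.ker, ker_mkQ_baseChange hle, Submodule.map_comap_eq,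
    ← Submodule.baseChange, inf_eq_right.2 (Submodule.baseChange_mono ℂ hle)]

theorem IsMHS.isOpposed (h : IsMHS W F) :
    IsOpposed (conj V) (fun k => (W k).baseChange ℂ) F where
  involutive := conj_conj
  monotone_W _ _ hab := Submodule.baseChange_mono ℂ (h.monotone_W hab)
  exists_W_eq_bot := h.exists_W_bot.imp fun a ha => by simp only [ha, Submodule.baseChange_bot]
  exists_W_eq_top := h.exists_W_top.imp fun b hb => by simp only [hb, Submodule.baseChange_top]
  antitone_F := h.antitone_F
  exists_F_eq_top := h.exists_F_top
  exists_F_eq_bot := h.exists_F_bot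
  W_le_comap k := baseChange_le_comap_conj _
  W_le k p q hpq := by
    have hsup := ((h.pure k).isCompl p q hpq).sup_eq_top
    rw [conjSub_grF] at hsup
    rw [← grPreimage_top, ← hsup, ← grPreimage_grF h.monotone_W,
      ← grPreimage_grF (F := fun q => (F q).comap (conj V)) h.monotone_W]
    exact grPreimage_sup_le _ _
  inf_le k p q hpq := by
    have hinf := ((h.pure k).isCompl p q hpq).inf_eq_bot
    rw [conjSub_grF] at hinf
    rw [← grPreimage_bot h.monotone_W, ← hinf, grPreimage_inf, ← grPreimage_grF h.monotone_W,
      ← grPreimage_grF (F := fun q => (F q).comap (conj V)) h.monotone_W]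

theorem sumOver_eq_iSup {R X : Type*} [Ring R] [AddCommGroup X] [Module R X]
    (I : ℤ → ℤ → Submodule R X) (P : ℤ → ℤ → Prop) :
    sumOver (fun i : ℤ × ℤ => I i.1 i.2) {i | P i.1 i.2} =
      ⨆ (r : ℤ) (s : ℤ) (_ : P r s), I r s := by
  rw [sumOver, iSup_prod]
  rfl

theorem IsDeligneBigrading.isBigrading {I : ℤ → ℤ → Submodule ℂ (Cx V)}
    (h : IsDeligneBigrading W F I) (hW : ∃ k, W k = ⊥) :
    IsBigrading (conj V) (fun k => (W k).baseChange ℂ) F (fun i => I i.1 i.2) where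
  involutive := conj_conj
  indep := h.isInternal.submodule_iSupIndep
  F_eq p := (h.F_eq p).trans (sumOver_eq_iSup I fun r _ => p ≤ r).symm
  W_eq k := (h.W_eq k).trans (sumOver_eq_iSup I fun r s => r + s ≤ k).symm
  exists_W_eq_bot := hW.imp fun k hk => by simp only [hk, Submodule.baseChange_bot]
  le_comap p q := by
    rw [← Submodule.map_le_iff_le_comap, sumOver_insert]
    exact le_sup_left.trans ((h.conj_mod q p).ge.trans
      (sup_le_sup_left (sumOver_eq_iSup I fun r s => r < q ∧ s < p).ge _))

theorem IsMHS.exists_isDeligneBigrading (h : IsMHS W F) :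
    ∃ I, IsDeligneBigrading W F I := by
  obtain ⟨I, hI, htop⟩ := h.isOpposed.exists_isBigrading
  refine ⟨fun p q => I (p, q), ?_, fun p => ?_, fun k => ?_, fun p q => ?_⟩
  · exact DirectSum.isInternal_submodule_of_iSupIndep_of_iSup_eq_top hI.indep htop
  · rw [hI.F_eq, ← sumOver_eq_iSup (fun p q => I (p, q)) fun r _ => p ≤ r]
  · rw [hI.W_eq k, ← sumOver_eq_iSup (fun p q => I (p, q)) fun r s => r + s ≤ k]
  · rw [← sumOver_eq_iSup (fun p q => I (p, q)) fun r s => r < p ∧ s < q, conjSub_eq_comap]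
    exact hI.conj_mod p q

theorem VGPMHS.isDeligneBigrading {E : Type*} [NormedAddCommGroup E] [NormedSpace ℂ E]
    {S : Type*} [TopologicalSpace S] [ChartedSpace E S] (𝒱 : VGPMHS E S) (s : S) :
    IsDeligneBigrading (𝒱.W s) (𝒱.F s) (𝒱.I s) :=
  Classical.epsilon_spec (𝒱.isMHS s).exists_isDeligneBigrading

end MixedHodgeStructures

section SmoothFamilies

variable (E : Type*) [NormedAddCommGroup E] [NormedSpace ℝ E]
  {S : Type*} [TopologicalSpace S] [ChartedSpace E S]

/-- `f` is `C^∞` at all points of some neighbourhood of `s₀`. -/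
def SmoothNear {G : Type*} [NormedAddCommGroup G] [NormedSpace ℝ G] (f : S → G) (s₀ : S) : Prop :=
  ∀ᶠ s in 𝓝 s₀, ContMDiffAt 𝓘(ℝ, E) 𝓘(ℝ, G) ∞ f s

variable {E}

namespace SmoothNear

variable {G H K : Type*} [NormedAddCommGroup G] [NormedSpace ℝ G] [NormedAddCommGroup H]
  [NormedSpace ℝ H] [NormedAddCommGroup K] [NormedSpace ℝ K] {f : S → G} {g : S → H} {s₀ : S}

theorem const (y : G) : SmoothNear E (fun _ : S => y) s₀ :=
  .of_forall fun _ => contMDiffAt_const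

theorem comp {Φ : G → H} (hΦ : ContDiff ℝ ∞ Φ) (hf : SmoothNear E f s₀) :
    SmoothNear E (fun s => Φ (f s)) s₀ :=
  hf.mono fun _ hs => hΦ.comp_contMDiffAt hs

theorem comp₂ {Φ : G × H → K} (hΦ : ContDiff ℝ ∞ Φ) (hf : SmoothNear E f s₀)
    (hg : SmoothNear E g s₀) : SmoothNear E (fun s => Φ (f s, g s)) s₀ := by
  filter_upwards [hf, hg] with s hf hg using hΦ.comp_contMDiffAt (hf.prodMk_space hg)

theorem add {g : S → G} (hf : SmoothNear E f s₀) (hg : SmoothNear E g s₀) :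
    SmoothNear E (fun s => f s + g s) s₀ :=
  hf.comp₂ contDiff_add hg

theorem sub {g : S → G} (hf : SmoothNear E f s₀) (hg : SmoothNear E g s₀) :
    SmoothNear E (fun s => f s - g s) s₀ :=
  hf.comp₂ (contDiff_fst.sub contDiff_snd) hg

theorem sum {ι : Type*} (t : Finset ι) {f : ι → S → G} (hf : ∀ i ∈ t, SmoothNear E (f i) s₀) :
    SmoothNear E (fun s => ∑ i ∈ t, f i s) s₀ := by
  filter_upwards [(Filter.eventually_all_finset t).2 hf] with s hs
  simpa only [Finset.sum_apply] using contMDiffAt_finsetSum hs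

theorem continuousAt (hf : SmoothNear E f s₀) : ContinuousAt f s₀ :=
  hf.self_of_nhds.continuousAt

variable {X Y : Type*} [NormedAddCommGroup X] [NormedSpace ℂ X] [NormedAddCommGroup Y]
  [NormedSpace ℂ Y]

theorem clm_apply {g : S → X →L[ℂ] Y} {f : S → X} (hg : SmoothNear E g s₀)
    (hf : SmoothNear E f s₀) : SmoothNear E (fun s => g s (f s)) s₀ :=
  hg.comp₂ (Φ := fun p : (X →L[ℂ] Y) × X => p.1 p.2)
    ((isBoundedBilinearMap_apply (𝕜 := ℂ)).contDiff.restrict_scalars ℝ) hf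

theorem clm_mul {g f : S → X →L[ℂ] X} (hg : SmoothNear E g s₀) (hf : SmoothNear E f s₀) :
    SmoothNear E (fun s => g s * f s) s₀ :=
  hg.comp₂ (Φ := fun p => p.1 * p.2)
    ((isBoundedBilinearMap_comp (𝕜 := ℂ)).contDiff.restrict_scalars ℝ) hf

theorem inverse [CompleteSpace X] {g : S → X →L[ℂ] X} (hg : SmoothNear E g s₀)
    (hu : ∀ᶠ s in 𝓝 s₀, IsUnit (g s)) : SmoothNear E (fun s => Ring.inverse (g s)) s₀ := by
  filter_upwards [hg, hu] with s hs ⟨u, hu⟩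
  have hinv : ContDiffAt ℂ ∞ Ring.inverse (g s) := hu ▸ contDiffAt_ringInverse ℂ u
  exact (hinv.restrict_scalars ℝ).comp_contMDiffAt hs

end SmoothNear

variable {X : Type*} [NormedAddCommGroup X] [NormedSpace ℂ X]

variable (E) in
/-- A germ at `s₀` of a smooth gauge transformation of the trivial bundle with fibre `X`,
normalized to be the identity at `s₀`. -/
structure IsGauge (g : S → X →L[ℂ] X) (s₀ : S) : Prop where
  smooth : SmoothNear E g s₀
  eq_one : g s₀ = 1

namespace IsGauge

variable {g : S → X →L[ℂ] X} {s₀ : S}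

theorem one : IsGauge E (fun _ : S => (1 : X →L[ℂ] X)) s₀ :=
  ⟨.const 1, rfl⟩

theorem mul {h : S → X →L[ℂ] X} (hg : IsGauge E g s₀) (hh : IsGauge E h s₀) :
    IsGauge E (fun s => g s * h s) s₀ :=
  ⟨hg.smooth.clm_mul hh.smooth, by simp [hg.eq_one, hh.eq_one]⟩

variable [CompleteSpace X]

theorem eventually_isUnit (hg : IsGauge E g s₀) : ∀ᶠ s in 𝓝 s₀, IsUnit (g s) :=
  hg.smooth.continuousAt.eventually (Units.isOpen.mem_nhds (by simp [hg.eq_one]))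

theorem eventually_injective (hg : IsGauge E g s₀) : ∀ᶠ s in 𝓝 s₀, Function.Injective (g s) :=
  hg.eventually_isUnit.mono fun _ hu => (ContinuousLinearMap.isUnit_iff_bijective.1 hu).injective

theorem inverse (hg : IsGauge E g s₀) : IsGauge E (fun s => Ring.inverse (g s)) s₀ :=
  ⟨hg.smooth.inverse hg.eventually_isUnit, by simp [hg.eq_one]⟩

theorem eventually_inverse_apply_self (hg : IsGauge E g s₀) :
    ∀ᶠ s in 𝓝 s₀, ∀ x, Ring.inverse (g s) (g s x) = x :=
  hg.eventually_isUnit.mono fun s hu => DFunLike.congr_fun (Ring.inverse_mul_cancel (g s) hu)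

end IsGauge

variable (E) in
/-- Near `s₀`, the subspaces `A s` are the images of `A s₀` under a smooth gauge transformation:
`A` is a smooth subbundle of the trivial bundle near `s₀`. -/
def IsSmoothFamily (A : S → Submodule ℂ X) (s₀ : S) : Prop :=
  ∃ g : S → X →L[ℂ] X, IsGauge E g s₀ ∧ ∀ᶠ s in 𝓝 s₀, A s = (A s₀).map (g s).toLinearMap

variable (E) in
/-- Near `s₀`, a smooth gauge transformation maps `A s` into `A s₀`; the dimension of `A s` is
allowed to drop. -/
def IsUpperFamily (A : S → Submodule ℂ X) (s₀ : S) : Prop :=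
  ∃ g : S → X →L[ℂ] X, IsGauge E g s₀ ∧ ∀ᶠ s in 𝓝 s₀, (A s).map (g s).toLinearMap ≤ A s₀

variable {A B : S → Submodule ℂ X} {s₀ : S}

theorem isSmoothFamily_const (P : Submodule ℂ X) : IsSmoothFamily E (fun _ : S => P) s₀ :=
  ⟨_, .one, .of_forall fun _ => (Submodule.map_id P).symm⟩

theorem IsSmoothFamily.congr (hA : IsSmoothFamily E A s₀) (h : ∀ᶠ s in 𝓝 s₀, B s = A s) :
    IsSmoothFamily E B s₀ := by
  obtain ⟨g, hg, hgA⟩ := hA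
  refine ⟨g, hg, ?_⟩
  filter_upwards [hgA, h] with s hgA hs
  rw [hs, hgA, h.self_of_nhds]

theorem IsUpperFamily.congr (hA : IsUpperFamily E A s₀) (h : ∀ᶠ s in 𝓝 s₀, B s = A s) :
    IsUpperFamily E B s₀ := by
  obtain ⟨g, hg, hgA⟩ := hA
  refine ⟨g, hg, ?_⟩
  filter_upwards [hgA, h] with s hgA hs
  rwa [hs, h.self_of_nhds]

theorem IsSmoothFamily.isUpperFamily [CompleteSpace X] (hA : IsSmoothFamily E A s₀) :
    IsUpperFamily E A s₀ := by
  obtain ⟨g, hg, hgA⟩ := hA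
  refine ⟨_, hg.inverse, ?_⟩
  filter_upwards [hgA, hg.eventually_inverse_apply_self] with s hs hinv
  rw [hs]
  rintro _ ⟨_, ⟨x, hx, rfl⟩, rfl⟩
  exact (hinv x).symm ▸ hx

variable [FiniteDimensional ℂ X]

theorem IsUpperFamily.finrank_le (hA : IsUpperFamily E A s₀) :
    ∀ᶠ s in 𝓝 s₀, Module.finrank ℂ (A s) ≤ Module.finrank ℂ (A s₀) := by
  have := FiniteDimensional.complete ℂ X
  obtain ⟨g, hg, hgA⟩ := hA
  filter_upwards [hgA, hg.eventually_injective] with s hs hinj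
  rw [(Submodule.equivMapOfInjective (g s).toLinearMap hinj (A s)).finrank_eq]
  exact Submodule.finrank_mono hs

theorem IsUpperFamily.isSmoothFamily (hA : IsUpperFamily E A s₀)
    (hdim : ∀ᶠ s in 𝓝 s₀, Module.finrank ℂ (A s) = Module.finrank ℂ (A s₀)) :
    IsSmoothFamily E A s₀ := by
  have := FiniteDimensional.complete ℂ X
  obtain ⟨g, hg, hgA⟩ := hA
  refine ⟨_, hg.inverse, ?_⟩
  filter_upwards [hgA, hg.eventually_injective, hg.eventually_inverse_apply_self, hdim]
    with s hs hinj hinv hdim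
  have hmap : (A s).map (g s).toLinearMap = A s₀ := by
    refine Submodule.eq_of_le_of_finrank_eq hs ?_
    rw [← (Submodule.equivMapOfInjective (g s).toLinearMap hinj (A s)).finrank_eq, hdim]
  rw [← hmap, ← Submodule.map_comp]
  ext x
  simp [hinv]

theorem exists_clm_of_disjoint {P Q : Submodule ℂ X} (h : Disjoint P Q) :
    ∃ π : X →L[ℂ] X, (∀ x, π x ∈ P) ∧ (∀ x ∈ P, π x = x) ∧ ∀ x ∈ Q, π x = 0 := by
  obtain ⟨C, hQC, hC⟩ := h.symm.exists_isCompl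
  exact ⟨(P.projection C hC.symm).toContinuousLinearMap,
    Submodule.projection_apply_mem hC.symm, fun x => Submodule.projection_apply_of_mem_left hC.symm,
    fun x hx => (Submodule.projection_apply_eq_zero_iff hC.symm).2 (hQC hx)⟩

theorem exists_clm_eqOn_inf (P Q : Submodule ℂ X) :
    ∃ π ρ : X →L[ℂ] X, (∀ x, π x ∈ P ⊓ Q) ∧ (∀ x ∈ P ⊓ Q, π x = x) ∧
      (∀ x ∈ P, ρ x = x) ∧ ∀ x ∈ Q, ρ x = π x := by
  obtain ⟨C, hC⟩ := exists_isCompl (P ⊓ Q)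
  obtain ⟨π, hπ_mem, hπ_id, hπ_zero⟩ := exists_clm_of_disjoint hC.disjoint
  have hdisj : Disjoint P (Q ⊓ C) := by
    rw [disjoint_iff, ← inf_assoc]
    exact hC.inf_eq_bot
  obtain ⟨ρ, -, hρ_id, hρ_zero⟩ := exists_clm_of_disjoint hdisj
  have hQ : Q = (P ⊓ Q) ⊔ (Q ⊓ C) := by
    rw [inf_comm Q C, ← sup_inf_assoc_of_le _ inf_le_right, hC.sup_eq_top, top_inf_eq]
  refine ⟨π, ρ, hπ_mem, hπ_id, hρ_id, fun x hx => ?_⟩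
  rw [hQ] at hx
  obtain ⟨y, hy, z, hz, rfl⟩ := Submodule.mem_sup.1 hx
  rw [map_add, map_add, hπ_id y hy, hπ_zero z hz.2, hρ_id y hy.1, hρ_zero z hz]

theorem IsUpperFamily.inf (hA : IsUpperFamily E A s₀) (hB : IsUpperFamily E B s₀) :
    IsUpperFamily E (fun s => A s ⊓ B s) s₀ := by
  obtain ⟨g, hg, hgA⟩ := hA
  obtain ⟨h, hh, hhB⟩ := hB
  obtain ⟨π, ρ, hπ_mem, -, hρA, hρB⟩ := exists_clm_eqOn_inf (A s₀) (B s₀)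
  -- On `A s ⊓ B s` the first summand vanishes and the second equals `(ρ - π) (h s x) = 0`.
  refine ⟨fun s => (1 - ρ) * g s + (ρ - π) * h s + π, ⟨?_, by simp [hg.eq_one, hh.eq_one]⟩, ?_⟩
  · exact (((SmoothNear.const _).clm_mul hg.smooth).add
      ((SmoothNear.const _).clm_mul hh.smooth)).add (SmoothNear.const _)
  · filter_upwards [hgA, hhB] with s hA hB
    rintro _ ⟨x, ⟨hxA, hxB⟩, rfl⟩
    have hρg : ρ (g s x) = g s x := hρA _ (hA ⟨x, hxA, rfl⟩)
    have hρh : ρ (h s x) = π (h s x) := hρB _ (hB ⟨x, hxB, rfl⟩)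
    have hval : ((1 - ρ) * g s + (ρ - π) * h s + π) x = π x := by simp [hρg, hρh]
    exact hval ▸ hπ_mem x

theorem exists_gauge_of_iSupIndep {ι : Type*} (t : Finset ι) {A : S → ι → Submodule ℂ X}
    (hA : ∀ i ∈ t, IsSmoothFamily E (fun s => A s i) s₀) (hind : iSupIndep (A s₀)) :
    ∃ g : S → X →L[ℂ] X, IsGauge E g s₀ ∧
      ∀ᶠ s in 𝓝 s₀, ∀ i ∈ t, A s i = (A s₀ i).map (g s).toLinearMap := by
  classical
  have hproj : ∀ i, ∃ π : X →L[ℂ] X, (∀ x ∈ A s₀ i, π x = x) ∧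
      ∀ j ≠ i, ∀ x ∈ A s₀ j, π x = 0 := by
    intro i
    obtain ⟨π, -, hπ_id, hπ_zero⟩ := exists_clm_of_disjoint (hind i)
    exact ⟨π, hπ_id, fun j hj x hx => hπ_zero x (le_iSup₂ (f := fun j _ => A s₀ j) j hj hx)⟩
  choose π hπ_id hπ_zero using hproj
  choose! g hg hgA using hA
  refine ⟨fun s => 1 + ∑ i ∈ t, (g i s - 1) * π i, ⟨?_, ?_⟩, ?_⟩
  · exact (SmoothNear.const _).add (SmoothNear.sum t fun i hi =>
      ((hg i hi).smooth.sub (SmoothNear.const _)).clm_mul (SmoothNear.const _))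
  · simpa using Finset.sum_eq_zero fun i hi => by rw [(hg i hi).eq_one, sub_self, zero_mul]
  · filter_upwards [(Filter.eventually_all_finset t).2 hgA] with s hgA i hi
    rw [hgA i hi]
    refine SetLike.coe_injective (Set.image_congr fun x hx => ?_)
    simp only [add_apply, sum_apply, ContinuousLinearMap.coe_coe]
    rw [Finset.sum_eq_single_of_mem i hi fun j _ hji => by simp [hπ_zero j i hji.symm x hx]]
    simp [hπ_id i x hx]

theorem IsSmoothFamily.sumOver {ι : Type*} (t : Finset ι) {A : S → ι → Submodule ℂ X}
    (hA : ∀ i ∈ t, IsSmoothFamily E (fun s => A s i) s₀) (hind : iSupIndep (A s₀)) :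
    IsSmoothFamily E (fun s => sumOver (A s) t) s₀ := by
  obtain ⟨g, hg, hgA⟩ := exists_gauge_of_iSupIndep t hA hind
  refine ⟨g, hg, ?_⟩
  filter_upwards [hgA] with s hgA
  simp only [MixedHodge.sumOver, Submodule.map_iSup]
  exact iSup_congr fun i => iSup_congr fun hi => hgA i hi

theorem IsSmoothFamily.sup (hA : IsSmoothFamily E A s₀) (hB : IsSmoothFamily E B s₀)
    (hd : Disjoint (A s₀) (B s₀)) : IsSmoothFamily E (fun s => A s ⊔ B s) s₀ := by
  refine (IsSmoothFamily.sumOver (A := fun s b => cond b (A s) (B s)) .univ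
    (Bool.forall_bool.2 ⟨fun _ => hB, fun _ => hA⟩) ?_).congr ?_
  · exact (iSupIndep_pair Bool.true_eq_false_eq_False (by decide)).2 hd
  · simp [MixedHodge.sumOver, iSup_bool_eq]

/-- Conjugation `φ ↦ c ∘ φ ∘ c` of endomorphisms, as a real-linear map. -/
def conjCLM (c : X →ₛₗ[starRingEnd ℂ] X) : (X →L[ℂ] X) →ₗ[ℝ] (X →L[ℂ] X) where
  toFun φ := (c.comp (φ.toLinearMap.comp c)).toContinuousLinearMap
  map_add' φ ψ := by ext; simp
  map_smul' r φ := by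
    ext x
    simpa using map_smulₛₗ c (r : ℂ) (φ (c x))

theorem conjCLM_apply (c : X →ₛₗ[starRingEnd ℂ] X) (φ : X →L[ℂ] X) (x : X) :
    conjCLM c φ x = c (φ (c x)) := rfl

theorem IsSmoothFamily.comap {c : X →ₛₗ[starRingEnd ℂ] X} (hc : Function.Involutive c)
    (hA : IsSmoothFamily E A s₀) : IsSmoothFamily E (fun s => (A s).comap c) s₀ := by
  obtain ⟨g, hg, hgA⟩ := hA
  have : FiniteDimensional ℝ (X →L[ℂ] X) := FiniteDimensional.complexToReal _
  refine ⟨fun s => conjCLM c (g s), ⟨hg.smooth.comp (conjCLM c).toContinuousLinearMap.contDiff, ?_⟩,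
    ?_⟩
  · ext x
    simp [hg.eq_one, conjCLM_apply, hc x]
  · filter_upwards [hgA] with s hgA
    simp only [← map_eq_comap_of_involutive hc, hgA]
    ext y
    simp [conjCLM_apply, hc _]

theorem exists_dual_family {ι : Type*} {v : ι → X} (hv : LinearIndependent ℂ v)
    [DecidableEq ι] :
    ∃ φ : ι → X →L[ℂ] ℂ, ∀ i j, φ j (v i) = if i = j then 1 else 0 := by
  obtain ⟨f, hf⟩ := LinearMap.exists_extend hv.repr
  refine ⟨fun j => (Finsupp.lapply j ∘ₗ f).toContinuousLinearMap, fun i j => ?_⟩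
  have hfv : f (v i) = Finsupp.single i 1 :=
    (LinearMap.congr_fun hf ⟨v i, Submodule.subset_span ⟨i, rfl⟩⟩).trans (hv.repr_eq_single i _ rfl)
  simp [hfv, Finsupp.single_apply]

theorem isSmoothFamily_of_frame {ι : Type*} [Finite ι] (e : ι → S → X)
    (he : ∀ j, SmoothNear E (e j) s₀) (hli : LinearIndependent ℂ fun j => e j s₀)
    (hA : ∀ᶠ s in 𝓝 s₀, Submodule.span ℂ (Set.range fun j => e j s) = A s) :
    IsSmoothFamily E A s₀ := by
  classical
  have := Fintype.ofFinite ι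
  obtain ⟨φ, hφ⟩ := exists_dual_family hli
  refine ⟨fun s => 1 + ∑ j, (φ j).smulRight (e j s - e j s₀), ⟨?_, by simp⟩, ?_⟩
  · refine (SmoothNear.const _).add (SmoothNear.sum _ fun j _ => ?_)
    exact ((he j).sub (SmoothNear.const _)).comp
      (Φ := fun x => ContinuousLinearMap.smulRightL ℂ X X (φ j) x)
      ((ContinuousLinearMap.contDiff (𝕜 := ℂ) _).restrict_scalars ℝ)
  · filter_upwards [hA] with s hs
    have hframe : ∀ i, (1 + ∑ j, (φ j).smulRight (e j s - e j s₀)) (e i s₀) = e i s := by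
      simp [hφ]
    rw [← hs, ← hA.self_of_nhds, Submodule.map_span, ← Set.range_comp]
    simp only [Function.comp_def, ContinuousLinearMap.coe_coe, hframe]

theorem IsSmoothFamily.exists_graph_gauge (hA : IsSmoothFamily E A s₀) :
    ∃ (π : X →L[ℂ] X) (g : S → X →L[ℂ] X), IsGauge E g s₀ ∧
      ∀ᶠ s in 𝓝 s₀, A s = (A s₀).map (g s).toLinearMap ∧ ∀ x ∈ A s₀, π (g s x) = x := by
  have := FiniteDimensional.complete ℂ X
  obtain ⟨h, hh, hhA⟩ := hA
  obtain ⟨π, hπ_mem, hπ_id, -⟩ := exists_clm_of_disjoint (disjoint_bot_right (a := A s₀))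
  have hk : IsGauge E (fun s => π * h s + (1 - π)) s₀ :=
    ⟨((SmoothNear.const _).clm_mul hh.smooth).add (SmoothNear.const _), by simp [hh.eq_one]⟩
  refine ⟨π, fun s => h s * Ring.inverse (π * h s + (1 - π)), hh.mul hk.inverse, ?_⟩
  filter_upwards [hhA, hk.eventually_injective, hk.eventually_inverse_apply_self]
    with s hhA hinj hinv
  set k := π * h s + (1 - π) with hk_def
  have hk_apply : ∀ y ∈ A s₀, k y = π (h s y) := fun y hy => by simp [hk_def, hπ_id y hy]
  have hk_map : (A s₀).map k.toLinearMap = A s₀ := by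
    refine Submodule.eq_of_le_of_finrank_eq ?_
      (Submodule.equivMapOfInjective k.toLinearMap hinj (A s₀)).finrank_eq.symm
    rintro _ ⟨y, hy, rfl⟩
    exact (hk_apply y hy).symm ▸ hπ_mem _
  constructor
  · rw [hhA]
    nth_rw 2 [← hk_map]
    rw [← Submodule.map_comp]
    congr 1
    ext x
    simp [hinv]
  · intro x hx
    rw [← hk_map] at hx
    obtain ⟨y, hy, rfl⟩ := hx
    change π (h s (Ring.inverse k (k y))) = k y
    rw [hinv, hk_apply y hy]

theorem IsSmoothFamily.exists_frame (hA : IsSmoothFamily E A s₀) :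
    ∃ (π : X →L[ℂ] X) (m : ℕ) (b : Fin m → X) (e : Fin m → S → X),
      (∀ j, SmoothNear E (e j) s₀) ∧ ∀ᶠ s in 𝓝 s₀,
        LinearIndependent ℂ (fun j => e j s) ∧ Submodule.span ℂ (Set.range fun j => e j s) = A s ∧
        (∀ j, π (e j s) = b j) ∧ ∀ x ∈ A s, π x = 0 → x = 0 := by
  have := FiniteDimensional.complete ℂ X
  obtain ⟨π, g, hg, hgA⟩ := hA.exists_graph_gauge
  let b := Module.finBasis ℂ (A s₀)
  have hb_span : Submodule.span ℂ (Set.range fun j => (b j : X)) = A s₀ := by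
    rw [← Function.comp_def Subtype.val, Set.range_comp]
    exact (Submodule.map_span (A s₀).subtype _).symm.trans (by simp [b.span_eq])
  refine ⟨π, _, fun j => b j, fun j s => g s (b j),
    fun j => hg.smooth.clm_apply (SmoothNear.const _), ?_⟩
  filter_upwards [hgA, hg.eventually_injective] with s ⟨hgA, hπg⟩ hinj
  refine ⟨?_, ?_, fun j => hπg _ (b j).2, ?_⟩
  · exact (b.linearIndependent.map' _ (A s₀).ker_subtype).map' (g s).toLinearMap
      (LinearMap.ker_eq_bot.2 hinj)
  · have := congrArg (Submodule.map (g s).toLinearMap) hb_span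
    rwa [Submodule.map_span, ← Set.range_comp, ← hgA] at this
  · rw [hgA]
    rintro _ ⟨y, hy, rfl⟩ hx
    rw [← hπg y hy]
    simpa using congrArg (g s) hx

end SmoothFamilies

section BigradingSupport

variable {R X ι : Type*} [Ring R] [AddCommGroup X] [Module R X]

theorem sumOver_eq_sumOver_filter {I : ι → Submodule R X} {t : Finset ι} (ht : ∀ i ∉ t, I i = ⊥)
    (A : Set ι) [DecidablePred (· ∈ A)] : sumOver I A = sumOver I (t.filter (· ∈ A)) := by
  refine le_antisymm (sumOver_le fun i hi => ?_) (sumOver_mono fun i hi => ?_)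
  · by_cases hit : i ∈ t
    · exact le_sumOver (Finset.mem_filter.2 ⟨hit, hi⟩)
    · exact ht i hit ▸ bot_le
  · exact (Finset.mem_filter.1 hi).2

theorem IsBigrading.eq_bot_of_notMem_Icc {ν : R →+* R} {c : X →ₛₗ[ν] X} {W F : ℤ → Submodule R X}
    {I : ℤ × ℤ → Submodule R X} (h : IsBigrading c W F I) {a b : ℤ} (ha : W a = ⊥) (hb : F b = ⊥)
    {i : ℤ × ℤ} (hi : i ∉ Finset.Icc ((a - b, a - b) : ℤ × ℤ) (b, b)) : I i = ⊥ := by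
  have hF_bot : ∀ p, b ≤ p → F p = ⊥ := fun p hp => eq_bot_iff.2 (hb ▸ h.F_antitone hp)
  obtain ⟨p, q⟩ := i
  rcases le_or_gt b p with hp | hp
  · exact eq_bot_iff.2 (hF_bot p hp ▸ h.le_F p q)
  rcases le_or_gt b q with hq | hq
  · have hle : I (p, q) ≤ sumOver I (below p q) := by
      simpa [hF_bot q hq, LinearMap.ker_eq_bot.2 h.involutive.injective] using h.le_conj_F_sup p q
    have hdisj : Disjoint (sumOver I {(p, q)}) (sumOver I (below p q)) :=
      disjoint_sumOver h.indep (by simp [below])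
    rw [sumOver_singleton] at hdisj
    exact hdisj.eq_bot_of_le hle
  · rw [eq_bot_iff, ← ha, h.W_eq]
    refine le_sumOver ?_
    simp only [Finset.mem_Icc, Prod.mk_le_mk, Set.mem_ofPred_eq] at hi ⊢
    omega

theorem finrank_sumOver {K X : Type*} [DivisionRing K] [AddCommGroup X] [Module K X]
    [FiniteDimensional K X] {I : ι → Submodule K X} (h : iSupIndep I) (t : Finset ι) :
    Module.finrank K (sumOver I t) = ∑ i ∈ t, Module.finrank K (I i) := by
  classical
  induction t using Finset.induction_on with
  | empty =>
    have hbot : sumOver I (∅ : Set ι) = ⊥ := iSup_emptyset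
    rw [Finset.coe_empty, hbot, finrank_bot, Finset.sum_empty]
  | insert i t hi ih =>
    have hdisj : Disjoint (I i) (sumOver I t) := by
      rw [← sumOver_singleton (I := I) i]
      exact disjoint_sumOver h (by simpa using hi)
    have hrank := Submodule.finrank_sup_add_finrank_inf_eq (I i) (sumOver I t)
    rw [hdisj.eq_bot, finrank_bot, add_zero] at hrank
    rw [Finset.coe_insert, sumOver_insert, Finset.sum_insert hi, hrank, ih]

end BigradingSupport

section MovingFrame

variable {E : Type*} [NormedAddCommGroup E] [NormedSpace ℝ E]
  {S : Type*} [TopologicalSpace S] [ChartedSpace E S]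
  {X : Type*} [NormedAddCommGroup X] [NormedSpace ℂ X]
  {c : X →ₛₗ[starRingEnd ℂ] X} {W : ℤ → Submodule ℂ X} {F : S → ℤ → Submodule ℂ X}
  {I : S → ℤ × ℤ → Submodule ℂ X} {s₀ : S} {t : Finset (ℤ × ℤ)}

theorem exists_eventually_support (hI : ∀ᶠ s in 𝓝 s₀, IsBigrading c W (F s) (I s))
    (hF : ∀ p, IsSmoothFamily E (fun s => F s p) s₀) {b : ℤ} (hb : F s₀ b = ⊥) :
    ∃ t : Finset (ℤ × ℤ), ∀ᶠ s in 𝓝 s₀, ∀ i ∉ t, I s i = ⊥ := by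
  obtain ⟨a, ha⟩ := hI.self_of_nhds.exists_W_eq_bot
  obtain ⟨g, -, hgF⟩ := hF b
  refine ⟨Finset.Icc (a - b, a - b) (b, b), ?_⟩
  filter_upwards [hI, hgF] with s hs hgF i hi
  exact hs.eq_bot_of_notMem_Icc ha (by rw [hgF, hb, Submodule.map_bot]) hi

variable [FiniteDimensional ℂ X]

theorem isUpperFamily_of_isSmoothFamily_below
    (hI : ∀ᶠ s in 𝓝 s₀, IsBigrading c W (F s) (I s))
    (hF : ∀ p, IsSmoothFamily E (fun s => F s p) s₀)
    (ht : ∀ᶠ s in 𝓝 s₀, ∀ i ∉ t, I s i = ⊥) {p q : ℤ}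
    (hbelow : ∀ i ∈ below p q, IsSmoothFamily E (fun s => I s i) s₀) :
    IsUpperFamily E (fun s => I s (p, q)) s₀ := by
  classical
  have := FiniteDimensional.complete ℂ X
  have hI₀ := hI.self_of_nhds
  have hsum : IsSmoothFamily E (fun s => sumOver (I s) (below p q)) s₀ := by
    exact (IsSmoothFamily.sumOver (t.filter (· ∈ below p q))
      (fun i hi => hbelow i (Finset.mem_filter.1 hi).2) hI₀.indep).congr
      (ht.mono fun s hs => sumOver_eq_sumOver_filter hs _)
  have hconj := ((hF q).comap hI₀.involutive).sup hsum (hI₀.disjoint_conj_F_below p q)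
  refine ((hF p).isUpperFamily.inf
    ((isSmoothFamily_const (W (p + q))).isUpperFamily.inf hconj.isUpperFamily)).congr ?_
  exact hI.mono fun s hs => hs.eq_delignePiece p q

theorem isSmoothFamily_of_isUpperFamily_weight_le
    (hI : ∀ᶠ s in 𝓝 s₀, IsBigrading c W (F s) (I s))
    (ht : ∀ᶠ s in 𝓝 s₀, ∀ i ∉ t, I s i = ⊥) {k : ℤ}
    (hupper : ∀ i : ℤ × ℤ, i.1 + i.2 ≤ k → IsUpperFamily E (fun s => I s i) s₀) {i : ℤ × ℤ}
    (hi : i.1 + i.2 ≤ k) : IsSmoothFamily E (fun s => I s i) s₀ := by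
  classical
  by_cases hit : i ∉ t
  · exact (isSmoothFamily_const ⊥).congr (ht.mono fun s hs => hs i hit)
  let u := t.filter (· ∈ {i : ℤ × ℤ | i.1 + i.2 ≤ k})
  have hdim_W : ∀ᶠ s in 𝓝 s₀, ∑ j ∈ u, Module.finrank ℂ (I s j) = Module.finrank ℂ (W k) := by
    filter_upwards [hI, ht] with s hs hts
    rw [← finrank_sumOver hs.indep, hs.W_eq,
      sumOver_eq_sumOver_filter hts {i : ℤ × ℤ | i.1 + i.2 ≤ k}]
  have hdim_le : ∀ᶠ s in 𝓝 s₀, ∀ j ∈ u,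
      Module.finrank ℂ (I s j) ≤ Module.finrank ℂ (I s₀ j) :=
    (Filter.eventually_all_finset u).2 fun j hj => (hupper j (Finset.mem_filter.1 hj).2).finrank_le
  refine (hupper i hi).isSmoothFamily ?_
  filter_upwards [hdim_W, hdim_le] with s hW hle
  exact (Finset.sum_eq_sum_iff_of_le hle).1 (hW.trans hdim_W.self_of_nhds.symm) i
    (Finset.mem_filter.2 ⟨not_not.1 hit, hi⟩)

theorem isSmoothFamily_bigrading (hI : ∀ᶠ s in 𝓝 s₀, IsBigrading c W (F s) (I s))
    (hF : ∀ p, IsSmoothFamily E (fun s => F s p) s₀)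
    (ht : ∀ᶠ s in 𝓝 s₀, ∀ i ∉ t, I s i = ⊥) (i : ℤ × ℤ) :
    IsSmoothFamily E (fun s => I s i) s₀ := by
  obtain ⟨a, ha⟩ := hI.self_of_nhds.exists_W_eq_bot
  have hweight : ∀ n : ℕ, ∀ i : ℤ × ℤ, i.1 + i.2 ≤ a + n →
      IsSmoothFamily E (fun s => I s i) s₀ := by
    intro n
    induction n with
    | zero =>
      refine fun i hi => (isSmoothFamily_const ⊥).congr (hI.mono fun s hs => ?_)
      rw [eq_bot_iff, ← ha, hs.W_eq]
      exact le_sumOver (by simpa using hi)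
    | succ n ih =>
      refine fun i => isSmoothFamily_of_isUpperFamily_weight_le hI ht fun ⟨p, q⟩ hpq =>
        isUpperFamily_of_isSmoothFamily_below hI hF ht fun j hj => ih j ?_
      obtain ⟨hj₁, hj₂⟩ := mem_below.1 hj
      push_cast at hpq
      omega
  exact hweight (i.1 + i.2 - a).toNat i (by omega)

theorem exists_movingFrame (hI : ∀ᶠ s in 𝓝 s₀, IsBigrading c W (F s) (I s))
    (hF : ∀ p, IsSmoothFamily E (fun s => F s p) s₀) {b : ℤ} (hb : F s₀ b = ⊥) :
    ∃ g : S → X →L[ℂ] X, IsGauge E g s₀ ∧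
      ∀ᶠ s in 𝓝 s₀, ∀ i, I s i = (I s₀ i).map (g s).toLinearMap := by
  obtain ⟨t, ht⟩ := exists_eventually_support hI hF hb
  obtain ⟨g, hg, hgI⟩ := exists_gauge_of_iSupIndep t (A := I)
    (fun i _ => isSmoothFamily_bigrading hI hF ht i) hI.self_of_nhds.indep
  refine ⟨g, hg, ?_⟩
  filter_upwards [hgI, ht] with s hgI hts i
  by_cases hi : i ∈ t
  · exact hgI i hi
  · rw [hts i hi, ht.self_of_nhds i hi, Submodule.map_bot]

end MovingFrame

section TangentDerivative

variable {E : Type*} [NormedAddCommGroup E] [NormedSpace ℝ E]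
  {S : Type*} [TopologicalSpace S] [ChartedSpace E S]
  {G H : Type*} [NormedAddCommGroup G] [NormedSpace ℝ G] [NormedAddCommGroup H] [NormedSpace ℝ H]
  {f g : S → G} {s : S}

/-- The derivative of a vector-valued function, with the tangent space `T_s S` read as the model
space `E`. -/
def tangentDeriv (f : S → G) (s : S) : E →L[ℝ] G := mvfderiv 𝓘(ℝ, E) f s

theorem tangentDeriv_congr (h : f =ᶠ[𝓝 s] g) :
    (tangentDeriv f s : E →L[ℝ] G) = tangentDeriv g s :=
  h.mfderiv_eq

theorem tangentDeriv_const (y : G) : tangentDeriv (fun _ => y) s = (0 : E →L[ℝ] G) :=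
  mvfderiv_const y

theorem tangentDeriv_clm_comp (L : G →L[ℝ] H) (hf : MDifferentiableAt 𝓘(ℝ, E) 𝓘(ℝ, G) f s) :
    tangentDeriv (fun s => L (f s)) s = L.comp (tangentDeriv f s : E →L[ℝ] G) :=
  (L.hasMFDerivAt.comp s hf.hasMFDerivAt).mfderiv

theorem tangentDeriv_clm_apply {X Y : Type*} [NormedAddCommGroup X] [NormedSpace ℂ X]
    [NormedAddCommGroup Y] [NormedSpace ℂ Y] {g : S → X →L[ℂ] Y} {f : S → X}
    (hg : MDifferentiableAt 𝓘(ℝ, E) 𝓘(ℝ, X →L[ℂ] Y) g s)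
    (hf : MDifferentiableAt 𝓘(ℝ, E) 𝓘(ℝ, X) f s) (ξ : E) :
    tangentDeriv (fun s => g s (f s)) s ξ =
      tangentDeriv g s ξ (f s) + g s (tangentDeriv f s ξ) := by
  have hpair : HasMFDerivAt 𝓘(ℝ, E) 𝓘(ℝ, (X →L[ℂ] Y) × X) (fun s => (g s, f s)) s
      ((tangentDeriv g s : E →L[ℝ] X →L[ℂ] Y).prod (tangentDeriv f s : E →L[ℝ] X)) :=
    ⟨(hg.prodMk_space hf).continuousAt, hg.hasMFDerivAt.2.prodMk hf.hasMFDerivAt.2⟩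
  have happly := ((isBoundedBilinearMap_apply (𝕜 := ℂ) (E := X) (F := Y)).hasFDerivAt
    (g s, f s)).restrictScalars ℝ
  exact (DFunLike.congr_fun (HasMFDerivAt.comp s happly.hasMFDerivAt hpair).mfderiv ξ).trans
    (add_comm _ _)

theorem tangentDeriv_mem (hf : MDifferentiableAt 𝓘(ℝ, E) 𝓘(ℝ, G) f s) {P : Submodule ℝ G}
    (hP : IsClosed (P : Set G)) (hfP : ∀ᶠ s' in 𝓝 s, f s' ∈ P) (ξ : E) :
    tangentDeriv f s ξ ∈ P := by
  have := hP
  have hzero : (fun s => P.mkQL (f s)) =ᶠ[𝓝 s] fun _ => 0 :=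
    hfP.mono fun s' hs' => (Submodule.Quotient.mk_eq_zero P).2 hs'
  have hcomp := tangentDeriv_clm_comp P.mkQL hf
  rw [tangentDeriv_congr hzero, tangentDeriv_const] at hcomp
  exact (Submodule.Quotient.mk_eq_zero P).1 (DFunLike.congr_fun hcomp ξ).symm

end TangentDerivative

section FlatCoordinates

theorem map_sumOver {R X Y : Type*} [Ring R] [AddCommGroup X] [Module R X] [AddCommGroup Y]
    [Module R Y] (e : X →ₗ[R] Y) (I : ℤ × ℤ → Submodule R X) (A : Set (ℤ × ℤ)) :
    (sumOver I A).map e = sumOver (fun i => (I i).map e) A := by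
  simp only [sumOver, Submodule.map_iSup]

theorem IsBigrading.map {R X Y : Type*} [Ring R] [AddCommGroup X] [Module R X] [AddCommGroup Y]
    [Module R Y] {ν : R →+* R} {c : X →ₛₗ[ν] X} {c' : Y →ₛₗ[ν] Y} {W F : ℤ → Submodule R X}
    {I : ℤ × ℤ → Submodule R X} (h : IsBigrading c W F I) (e : X ≃ₗ[R] Y)
    (he : ∀ x, e (c x) = c' (e x)) :
    IsBigrading c' (fun k => (W k).map e.toLinearMap) (fun p => (F p).map e.toLinearMap)
      (fun i => (I i).map e.toLinearMap) where
  involutive := e.surjective.forall.2 fun x => by rw [← he, ← he, h.involutive]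
  indep := h.indep.map_orderIso (Submodule.orderIsoMapComap e)
  F_eq p := by rw [h.F_eq, map_sumOver]
  W_eq k := by rw [h.W_eq, map_sumOver]
  exists_W_eq_bot := h.exists_W_eq_bot.imp fun k hk => by rw [hk, Submodule.map_bot]
  le_comap p q := by
    rw [← map_sumOver, Submodule.map_le_iff_le_comap, ← Submodule.comap_comp]
    intro x hx
    exact ⟨c x, h.le_comap p q hx, he x⟩

namespace RationalLocalSystem

variable {S : Type*} [TopologicalSpace S] (L : RationalLocalSystem S) {s₀ s₁ s : S}

theorem chartC_tmul (s₀ s : S) (z : ℂ) (v : L.fiber s) :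
    L.chartC s₀ s (z ⊗ₜ[ℚ] v) = fun i => L.chart s₀ s v i • z := by
  ext i
  simp [chartC]

theorem chartC_conj (s₀ s : S) (x : L.fiberC s) :
    L.chartC s₀ s (conj _ x) = star (L.chartC s₀ s x) := by
  induction x using TensorProduct.induction_on with
  | zero => simp
  | tmul z w =>
    have hconj : conj _ (z ⊗ₜ[ℚ] w) = star z ⊗ₜ[ℚ] w := rfl
    rw [hconj, chartC_tmul, chartC_tmul]
    ext i
    simp [Rat.smul_def]
  | add x y hx hy => simp only [map_add, hx, hy, star_add]

/-- The complexified flat trivialization around `s₀`, at a point `s` of its domain. -/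
def chartEquivOf (hs : s ∈ L.dom s₀) : L.fiberC s ≃ₗ[ℂ] (Fin (L.rank s₀) → ℂ) :=
  LinearEquiv.ofBijective (L.chartC s₀ s) (L.bijective_chartC hs)

open Classical in
/-- The section with coordinates `f` in the flat trivialization around `s₀`, extended by zero
outside the domain of the latter. -/
def sectionOf (s₀ : S) (f : S → Fin (L.rank s₀) → ℂ) : L.Sec := fun s =>
  if hs : s ∈ L.dom s₀ then (L.chartEquivOf hs).symm (f s) else 0

theorem chartC_sectionOf (f : S → Fin (L.rank s₀) → ℂ) (hs : s ∈ L.dom s₀) :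
    L.chartC s₀ s (L.sectionOf s₀ f s) = f s := by
  rw [sectionOf, dif_pos hs]
  exact (L.chartEquivOf hs).apply_symm_apply (f s)

theorem chartC_mem_map (hs : s ∈ L.dom s₀) {P : Submodule ℂ (L.fiberC s)} {x : L.fiberC s} :
    L.chartC s₀ s x ∈ P.map (L.chartC s₀ s) ↔ x ∈ P :=
  (L.bijective_chartC hs).1.mem_set_image

theorem exists_transition (h₀ : s ∈ L.dom s₀) (h₁ : s ∈ L.dom s₁) :
    ∃ A : (Fin (L.rank s₀) → ℂ) →L[ℂ] (Fin (L.rank s₁) → ℂ),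
      ∀ᶠ s' in 𝓝 s, ∀ x, L.chartC s₁ s' x = A (L.chartC s₀ s' x) := by
  obtain ⟨A, hA⟩ := L.locallyConstant s₀ s₁ s ⟨h₀, h₁⟩
  refine ⟨((TensorProduct.piScalarRight ℚ ℂ ℂ (Fin (L.rank s₁))).toLinearMap ∘ₗ A.baseChange ℂ ∘ₗ
    (TensorProduct.piScalarRight ℚ ℂ ℂ (Fin (L.rank s₀))).symm.toLinearMap).toContinuousLinearMap,
    hA.mono fun s' hs' x => ?_⟩
  rw [chartC, hs', LinearMap.baseChange_comp]
  simp [chartC, -TensorProduct.piScalarRight_apply]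

variable (E : Type*) [NormedAddCommGroup E] [NormedSpace ℂ E] [ChartedSpace E S]

/-- The section `σ` is `C^∞` over `ℝ` at the point `s`. -/
abbrev IsSmoothAt (σ : L.Sec) (s : S) : Prop :=
  ContMDiffAt 𝓘(ℝ, E) 𝓘(ℝ, Fin (L.rank s) → ℂ) ∞ (fun s' => L.chartC s s' (σ s')) s

variable {E L} {σ : L.Sec}

theorem isSmoothAt_iff (hs : s ∈ L.dom s₀) : L.IsSmoothAt E σ s ↔
    ContMDiffAt 𝓘(ℝ, E) 𝓘(ℝ, Fin (L.rank s₀) → ℂ) ∞ (fun s' => L.chartC s₀ s' (σ s')) s := by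
  have change_chart : ∀ {a b : S}, s ∈ L.dom a → s ∈ L.dom b →
      ContMDiffAt 𝓘(ℝ, E) 𝓘(ℝ, Fin (L.rank a) → ℂ) ∞ (fun s' => L.chartC a s' (σ s')) s →
      ContMDiffAt 𝓘(ℝ, E) 𝓘(ℝ, Fin (L.rank b) → ℂ) ∞ (fun s' => L.chartC b s' (σ s')) s := by
    intro a b ha hb h
    obtain ⟨A, hA⟩ := L.exists_transition ha hb
    exact ((A.restrictScalars ℝ).contDiff.comp_contMDiffAt (n := ∞) h).congr_of_eventuallyEq
      (hA.mono fun s' hs' => hs' _)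
  exact ⟨change_chart (L.mem_dom s) hs, change_chart hs (L.mem_dom s)⟩

theorem isSmoothOn_sectionOf {f : S → Fin (L.rank s₀) → ℂ} {N : Set S} (hN : IsOpen N)
    (hNd : N ⊆ L.dom s₀)
    (hf : ∀ s ∈ N, ContMDiffAt 𝓘(ℝ, E) 𝓘(ℝ, Fin (L.rank s₀) → ℂ) ∞ f s) :
    L.IsSmoothOn E (L.sectionOf s₀ f) N := fun s hs =>
  (isSmoothAt_iff (hNd hs)).2 ((hf s hs).congr_of_eventuallyEq
    ((hN.eventually_mem hs).mono fun _ hs' => L.chartC_sectionOf f (hNd hs')))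

theorem chartC_nabla (hs : s ∈ L.dom s₀) (hσ : L.IsSmoothAt E σ s) (ξ : E) :
    L.chartC s₀ s (L.nabla σ s ξ) = tangentDeriv (fun s' => L.chartC s₀ s' (σ s')) s ξ := by
  obtain ⟨A, hA⟩ := L.exists_transition (L.mem_dom s) hs
  have hself : L.chartC s s (L.nabla σ s ξ) = tangentDeriv (fun s' => L.chartC s s' (σ s')) s ξ :=
    (L.chartEquiv s).apply_symm_apply _
  have hcomp := tangentDeriv_clm_comp (A.restrictScalars ℝ) (hσ.mdifferentiableAt (by simp))
  rw [tangentDeriv_congr (hA.mono fun s' hs' => hs' (σ s')), hA.self_of_nhds, hself]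
  exact (DFunLike.congr_fun hcomp ξ).symm

theorem IsSmoothAt.conj (hσ : L.IsSmoothAt E σ s) :
    L.IsSmoothAt E (fun s' => MixedHodge.conj _ (σ s')) s := by
  simp only [IsSmoothAt, chartC_conj]
  exact (starL' ℝ).toContinuousLinearMap.contDiff.comp_contMDiffAt (n := ∞) hσ

theorem nabla_conj (hσ : L.IsSmoothAt E σ s) (ξ : E) :
    L.nabla (fun s' => MixedHodge.conj _ (σ s')) s ξ = MixedHodge.conj _ (L.nabla σ s ξ) := by
  refine (L.bijective_chartC (L.mem_dom s)).1 ?_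
  rw [chartC_nabla (L.mem_dom s) hσ.conj, chartC_conj, chartC_nabla (L.mem_dom s) hσ]
  simp only [chartC_conj]
  exact DFunLike.congr_fun (tangentDeriv_clm_comp (starL' ℝ).toContinuousLinearMap
    (hσ.mdifferentiableAt (by simp))) ξ

theorem nabla_mem_of_flat (hσ : L.IsSmoothAt E σ s) {P : Submodule ℂ (L.fiberC s)}
    (hP : ∀ᶠ s' in 𝓝 s, L.chartC s s' (σ s') ∈ P.map (L.chartC s s)) (ξ : E) :
    L.nabla σ s ξ ∈ P := by
  rw [← L.chartC_mem_map (L.mem_dom s), chartC_nabla (L.mem_dom s) hσ]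
  exact tangentDeriv_mem (hσ.mdifferentiableAt (by simp))
    (P := (P.map (L.chartC s s)).restrictScalars ℝ) (Submodule.closed_of_finiteDimensional _) hP ξ

end RationalLocalSystem

end FlatCoordinates

section LocalFrames

theorem eventually_forall_eq_of_monotone {S α : Type*} [PartialOrder α] [BoundedOrder α]
    {l : Filter S} {A : S → ℤ → α} {A₀ : ℤ → α} (hA : ∀ s, Monotone (A s)) (hA₀ : Monotone A₀)
    (hconst : ∀ k, ∀ᶠ s in l, A s k = A₀ k) (hbot : ∃ k, A₀ k = ⊥) (htop : ∃ k, A₀ k = ⊤) :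
    ∀ᶠ s in l, ∀ k, A s k = A₀ k := by
  obtain ⟨a, ha⟩ := hbot
  obtain ⟨b, hb⟩ := htop
  filter_upwards [(Filter.eventually_all_finset (Finset.Icc a b)).2 fun k _ => hconst k,
    hconst a, hconst b] with s hs hsa hsb k
  rcases le_total k a with hka | hak
  · rw [eq_bot_mono (hA s hka) (hsa.trans ha), eq_bot_mono (hA₀ hka) ha]
  rcases le_total b k with hbk | hkb
  · rw [eq_top_mono (hA s hbk) (hsb.trans hb), eq_top_mono (hA₀ hbk) hb]
  · exact hs k (Finset.mem_Icc.2 ⟨hak, hkb⟩)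

namespace VGPMHS

variable {E : Type*} [NormedAddCommGroup E] [NormedSpace ℂ E]
  {S : Type*} [TopologicalSpace S] [ChartedSpace E S] (𝒱 : VGPMHS E S)

/-- The Deligne bigrading of the fibre at `s`, indexed by pairs. -/
def bigrading (s : S) (i : ℤ × ℤ) : Submodule ℂ (𝒱.fiberC s) := 𝒱.I s i.1 i.2

theorem U_eq_sumOver (p : ℤ) (s : S) : 𝒱.U p s = sumOver (𝒱.bigrading s) {i | i.1 = p} := by
  simp only [U, sumOver, bigrading, iSup_prod, Set.mem_ofPred_eq]
  rw [iSup_comm]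
  simp only [iSup_iSup_eq_left]

theorem isBigrading (s : S) :
    IsBigrading (conj _) (fun k => (𝒱.W s k).baseChange ℂ) (𝒱.F s) (𝒱.bigrading s) :=
  (𝒱.isDeligneBigrading s).isBigrading (𝒱.isMHS s).exists_W_bot

theorem eventually_map_W (s₀ : S) : ∀ᶠ s in 𝓝 s₀, ∀ k,
    ((𝒱.W s k).baseChange ℂ).map (𝒱.chartC s₀ s) =
      ((𝒱.W s₀ k).baseChange ℂ).map (𝒱.chartC s₀ s₀) := by
  have hmono : ∀ s, Monotone fun k => ((𝒱.W s k).baseChange ℂ).map (𝒱.chartC s₀ s) :=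
    fun s _ _ hkl => Submodule.map_mono (Submodule.baseChange_mono ℂ ((𝒱.isMHS s).monotone_W hkl))
  refine eventually_forall_eq_of_monotone hmono (hmono s₀) (fun k => ?_)
    ((𝒱.isMHS s₀).exists_W_bot.imp fun k hk => by
      simp only [hk, Submodule.baseChange_bot, Submodule.map_bot])
    ((𝒱.isMHS s₀).exists_W_top.imp fun k hk => by
      simp only [hk, Submodule.baseChange_top, Submodule.map_top, LinearMap.range_eq_top]
      exact (𝒱.bijective_chartC (𝒱.mem_dom s₀)).2)
  filter_upwards [𝒱.flat_W k s₀ s₀ (𝒱.mem_dom s₀)] with s hs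
  simp only [RationalLocalSystem.chartC, Submodule.map_comp, ← map_baseChange, hs]

theorem isSmoothFamily_map_F (s₀ : S) (p : ℤ) :
    IsSmoothFamily E (fun s => (𝒱.F s p).map (𝒱.chartC s₀ s)) s₀ := by
  obtain ⟨N, hN, hs₀, m, e, he, hspan⟩ := 𝒱.holomorphic_F p s₀
  have hNs₀ := hN.eventually_mem hs₀
  refine isSmoothFamily_of_frame (fun j s => 𝒱.chartC s₀ s (e j s)) (fun j => ?_)
    ((hspan s₀ hs₀).1.map' _ (LinearMap.ker_eq_bot.2 (𝒱.bijective_chartC (𝒱.mem_dom s₀)).1)) ?_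
  · filter_upwards [hNs₀, (𝒱.isOpen_dom s₀).eventually_mem (𝒱.mem_dom s₀)] with s hs hd
    exact (RationalLocalSystem.isSmoothAt_iff hd).1 ((he j).1 s hs)
  · filter_upwards [hNs₀] with s hs
    have hmap := congrArg (Submodule.map (𝒱.chartC s₀ s)) (hspan s hs).2
    rwa [Submodule.map_span, ← Set.range_comp] at hmap

/-- A smooth trivialization of `𝒱` near `s₀`, expressed as a gauge transformation of the flat
trivialization around `s₀`, that carries the Deligne bigrading at `s₀` to the one at `s`. -/
structure LocalFrame (s₀ : S) where
  toFun : S → (Fin (𝒱.rank s₀) → ℂ) →L[ℂ] (Fin (𝒱.rank s₀) → ℂ)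
  isGauge : IsGauge E toFun s₀
  map_bigrading : ∀ᶠ s in 𝓝 s₀, ∀ i, (𝒱.bigrading s i).map (𝒱.chartC s₀ s) =
    ((𝒱.bigrading s₀ i).map (𝒱.chartC s₀ s₀)).map (toFun s).toLinearMap

theorem nonempty_localFrame (s₀ : S) : Nonempty (𝒱.LocalFrame s₀) := by
  obtain ⟨b, hb⟩ := (𝒱.isMHS s₀).exists_F_bot
  have hI : ∀ᶠ s in 𝓝 s₀, IsBigrading (starLinearEquiv ℂ).toLinearMap
      (fun k => ((𝒱.W s₀ k).baseChange ℂ).map (𝒱.chartC s₀ s₀))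
      (fun p => (𝒱.F s p).map (𝒱.chartC s₀ s))
      (fun i => (𝒱.bigrading s i).map (𝒱.chartC s₀ s)) := by
    filter_upwards [𝒱.eventually_map_W s₀, (𝒱.isOpen_dom s₀).eventually_mem (𝒱.mem_dom s₀)]
      with s hs hd
    simp only [← hs]
    exact (𝒱.isBigrading s).map (𝒱.chartEquivOf hd) (𝒱.chartC_conj s₀ s)
  obtain ⟨g, hg, hgI⟩ := exists_movingFrame hI (𝒱.isSmoothFamily_map_F s₀) (b := b)
    (by rw [hb, Submodule.map_bot])
  exact ⟨⟨g, hg, hgI⟩⟩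

namespace LocalFrame

variable {𝒱} {s₀ : S} (φ : 𝒱.LocalFrame s₀)

theorem eventually_map_sumOver : ∀ᶠ s in 𝓝 s₀, ∀ A,
    (sumOver (𝒱.bigrading s) A).map (𝒱.chartC s₀ s) =
      ((sumOver (𝒱.bigrading s₀) A).map (𝒱.chartC s₀ s₀)).map (φ.toFun s).toLinearMap :=
  φ.map_bigrading.mono fun s hs A => by simp only [map_sumOver, hs]

include φ in
theorem exists_section (v : 𝒱.fiberC s₀) : ∃ N, IsOpen N ∧ s₀ ∈ N ∧ ∃ σ : 𝒱.Sec,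
    𝒱.IsSmoothOn E σ N ∧ σ s₀ = v ∧
      ∀ s ∈ N, ∀ A, v ∈ sumOver (𝒱.bigrading s₀) A → σ s ∈ sumOver (𝒱.bigrading s) A := by
  have hdom := (𝒱.isOpen_dom s₀).eventually_mem (𝒱.mem_dom s₀)
  have hsmooth : SmoothNear E (fun s => φ.toFun s (𝒱.chartC s₀ s₀ v)) s₀ :=
    φ.isGauge.smooth.clm_apply (.const _)
  obtain ⟨N, hN, hNo, hs₀⟩ := eventually_nhds_iff.1
    (hdom.and (hsmooth.and φ.eventually_map_sumOver))
  refine ⟨N, hNo, hs₀, 𝒱.sectionOf s₀ fun s => φ.toFun s (𝒱.chartC s₀ s₀ v),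
    RationalLocalSystem.isSmoothOn_sectionOf hNo (fun s hs => (hN s hs).1)
      fun s hs => (hN s hs).2.1, ?_, fun s hs A hv => ?_⟩
  · refine (𝒱.bijective_chartC (𝒱.mem_dom s₀)).1 ?_
    simp [𝒱.chartC_sectionOf _ (𝒱.mem_dom s₀), φ.isGauge.eq_one]
  · obtain ⟨hd, -, hA⟩ := hN s hs
    rw [← 𝒱.chartC_mem_map hd, 𝒱.chartC_sectionOf _ hd, hA]
    exact Submodule.mem_map_of_mem (Submodule.mem_map_of_mem hv)

/-- The connection form at `s₀` of the Gauss–Manin connection relative to a local frame. -/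
def connection : E →ₗ[ℝ] Module.End ℂ (𝒱.fiberC s₀) :=
  ((𝒱.chartEquiv s₀).symm.conj.toLinearMap.restrictScalars ℝ) ∘ₗ
    (ContinuousLinearMap.coeLM ℂ).restrictScalars ℝ ∘ₗ
      (tangentDeriv φ.toFun s₀ : E →L[ℝ] _).toLinearMap

theorem chartC_connection (ξ : E) (x : 𝒱.fiberC s₀) :
    𝒱.chartC s₀ s₀ (φ.connection ξ x) = tangentDeriv φ.toFun s₀ ξ (𝒱.chartC s₀ s₀ x) :=
  (𝒱.chartEquiv s₀).apply_symm_apply _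

theorem nabla_sub_connection_mem {σ : 𝒱.Sec} (hσ : 𝒱.IsSmoothAt E σ s₀) {A : Set (ℤ × ℤ)}
    (hA : ∀ᶠ s in 𝓝 s₀, σ s ∈ sumOver (𝒱.bigrading s) A) (ξ : E) :
    𝒱.nabla σ s₀ ξ - φ.connection ξ (σ s₀) ∈ sumOver (𝒱.bigrading s₀) A := by
  set f : S → Fin (𝒱.rank s₀) → ℂ :=
    fun s => Ring.inverse (φ.toFun s) (𝒱.chartC s₀ s (σ s)) with hf_def
  have hf : MDifferentiableAt 𝓘(ℝ, E) 𝓘(ℝ, Fin (𝒱.rank s₀) → ℂ) f s₀ := by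
    have happly := (isBoundedBilinearMap_apply (𝕜 := ℂ) (E := Fin (𝒱.rank s₀) → ℂ)
      (F := Fin (𝒱.rank s₀) → ℂ)).contDiff (n := ∞)
    exact ((happly.restrict_scalars ℝ).comp_contMDiffAt
      (φ.isGauge.inverse.smooth.self_of_nhds.prodMk_space hσ)).mdifferentiableAt (by simp)
  have hσf : (fun s => 𝒱.chartC s₀ s (σ s)) =ᶠ[𝓝 s₀] fun s => φ.toFun s (f s) := by
    filter_upwards [φ.isGauge.eventually_isUnit] with s hs
    exact (DFunLike.congr_fun (Ring.mul_inverse_cancel _ hs) _).symm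
  have hleibniz : 𝒱.chartC s₀ s₀ (𝒱.nabla σ s₀ ξ - φ.connection ξ (σ s₀)) =
      tangentDeriv f s₀ ξ := by
    rw [map_sub, RationalLocalSystem.chartC_nabla (𝒱.mem_dom s₀) hσ, φ.chartC_connection,
      tangentDeriv_congr hσf, tangentDeriv_clm_apply
        (φ.isGauge.smooth.self_of_nhds.mdifferentiableAt (by simp)) hf]
    simp [hf_def, φ.isGauge.eq_one]
  rw [← 𝒱.chartC_mem_map (𝒱.mem_dom s₀), hleibniz]
  refine tangentDeriv_mem hf (P := (Submodule.map _ _).restrictScalars ℝ)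
    (Submodule.closed_of_finiteDimensional _) ?_ ξ
  filter_upwards [hA, φ.eventually_map_sumOver, φ.isGauge.eventually_inverse_apply_self]
    with s hs hmap hinv
  obtain ⟨y, hy, hyx⟩ := (hmap A).le (Submodule.mem_map_of_mem hs)
  simp only [ContinuousLinearMap.coe_coe] at hyx
  rw [hf_def]
  simp only [← hyx, hinv]
  exact hy

end LocalFrame

end VGPMHS

end LocalFrames

section Components

variable {R X M ι : Type*} [Ring R] [AddCommGroup X] [Module R X] [AddCommGroup M] [Module R M]
  [DecidableEq ι] {I : ι → Submodule R X} {A B : Set ι} {x : X}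

theorem sumOver_univ (h : DirectSum.IsInternal I) : sumOver I Set.univ = ⊤ := by
  rw [sumOver, iSup_univ, h.submodule_iSup_eq_top]

theorem isCompl_sumOver (h : DirectSum.IsInternal I) (A : Set ι) :
    IsCompl (sumOver I A) (sumOver I Aᶜ) where
  disjoint := disjoint_sumOver h.submodule_iSupIndep disjoint_compl_right
  codisjoint := by rw [codisjoint_iff, ← sumOver_union, Set.union_compl_self, sumOver_univ h]

/-- The projection of `X = ⨁ I i` to the sum of the `I i` with `i ∈ A`. -/
def component (h : DirectSum.IsInternal I) (A : Set ι) : Module.End R X :=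
  Submodule.projection _ _ (isCompl_sumOver h A)

theorem component_of_mem (h : DirectSum.IsInternal I) (hx : x ∈ sumOver I A) :
    component h A x = x :=
  Submodule.projection_apply_of_mem_left _ hx

theorem component_eq_zero_iff (h : DirectSum.IsInternal I) :
    component h A x = 0 ↔ x ∈ sumOver I Aᶜ :=
  Submodule.projection_apply_eq_zero_iff _

theorem component_mem (h : DirectSum.IsInternal I) (A : Set ι) (x : X) :
    component h A x ∈ sumOver I A :=
  Submodule.projection_apply_mem _ x

theorem sub_component_mem (h : DirectSum.IsInternal I) (A : Set ι) (hx : x ∈ sumOver I B) :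
    x - component h A x ∈ sumOver I (B \ A) := by
  rw [← Set.inter_union_sdiff B A, sumOver_union] at hx
  obtain ⟨y, hy, z, hz, rfl⟩ := Submodule.mem_sup.1 hx
  have hyA : component h A y = y := component_of_mem h (sumOver_mono Set.inter_subset_right hy)
  have hzA : component h A z = 0 :=
    (component_eq_zero_iff h).2 (sumOver_mono (fun _ hi => hi.2) hz)
  rwa [map_add, hyA, hzA, add_zero, add_sub_cancel_left]

theorem component_mem_inter (h : DirectSum.IsInternal I) (A : Set ι) (hx : x ∈ sumOver I B) :
    component h A x ∈ sumOver I (B ∩ A) := by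
  rw [← sumOver_inf_sumOver h.submodule_iSupIndep]
  refine ⟨?_, component_mem h A x⟩
  rw [← sub_sub_cancel x (component h A x)]
  exact Submodule.sub_mem _ hx (sumOver_mono Set.sdiff_subset (sub_component_mem h A hx))

theorem linearMap_ext_of_isInternal (h : DirectSum.IsInternal I) {f g : X →ₗ[R] M}
    (hfg : ∀ i, ∀ x ∈ I i, f x = g x) : f = g :=
  LinearMap.ext_on_range (v := fun x : Σ i, I i => (x.2 : X))
    (by
      rw [eq_top_iff, ← h.submodule_iSup_eq_top]
      exact iSup_le fun i x hx => Submodule.subset_span ⟨⟨i, x, hx⟩, rfl⟩)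
    fun x => hfg x.1 x.2 x.2.2

theorem sum_component (h : DirectSum.IsInternal I) {t : Finset ι} (ht : ∀ i ∉ t, I i = ⊥) :
    ∑ i ∈ t, component h {i} = 1 := by
  refine linearMap_ext_of_isInternal h fun i x hx => ?_
  rw [LinearMap.sum_apply, Module.End.one_apply, Finset.sum_eq_single i]
  · exact component_of_mem h (le_sumOver (Set.mem_singleton i) hx)
  · exact fun j _ hji => (component_eq_zero_iff h).2 (le_sumOver (A := {j}ᶜ) hji.symm hx)
  · intro hi
    rw [ht i hi, Submodule.mem_bot] at hx
    rw [hx, map_zero]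

/-- The linear map that agrees with `φ i` on `I i`. -/
def glue (h : DirectSum.IsInternal I) (φ : ∀ i, I i →ₗ[R] M) : X →ₗ[R] M :=
  DirectSum.toModule R ι M φ ∘ₗ
    (LinearEquiv.ofBijective (DirectSum.coeLinearMap I) h).symm.toLinearMap

theorem glue_apply (h : DirectSum.IsInternal I) (φ : ∀ i, I i →ₗ[R] M) {i : ι} (hx : x ∈ I i) :
    glue h φ x = φ i ⟨x, hx⟩ := by
  have hsymm : (LinearEquiv.ofBijective (DirectSum.coeLinearMap I) h).symm x =
      DirectSum.lof R ι (fun i => I i) i ⟨x, hx⟩ :=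
    (LinearEquiv.symm_apply_eq _).2 (DirectSum.coeLinearMap_lof I i ⟨x, hx⟩).symm
  rw [glue, LinearMap.comp_apply, LinearEquiv.coe_coe, hsymm, DirectSum.toModule_lof]

end Components

section AdEigenspaces

variable {X ι : Type*} [AddCommGroup X] [Module ℂ X] [DecidableEq ι]
  {I : ι → Submodule ℂ X} {w : ι → ℂ} {Y f g : Module.End ℂ X}

theorem mul_component (h : DirectSum.IsInternal I) (hY : ∀ i, ∀ x ∈ I i, Y x = w i • x) (i : ι) :
    Y * component h {i} = w i • component h {i} :=
  LinearMap.ext fun x => hY i _ (sumOver_singleton (I := I) i ▸ component_mem h {i} x)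

theorem component_mul (h : DirectSum.IsInternal I) (hY : ∀ i, ∀ x ∈ I i, Y x = w i • x) (i : ι) :
    component h {i} * Y = w i • component h {i} := by
  refine linearMap_ext_of_isInternal h fun j x hx => ?_
  rw [Module.End.mul_apply, hY j x hx, map_smul, LinearMap.smul_apply]
  obtain rfl | hji := eq_or_ne j i
  · rfl
  · rw [(component_eq_zero_iff h).2 (le_sumOver (A := {i}ᶜ) hji hx), smul_zero, smul_zero]

theorem component_mul_component_mem_eigenspace_ad (h : DirectSum.IsInternal I)
    (hY : ∀ i, ∀ x ∈ I i, Y x = w i • x) (f : Module.End ℂ X) (i j : ι) :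
    component h {j} * f * component h {i} ∈ Module.End.eigenspace (ad Y) (w j - w i) := by
  rw [Module.End.mem_eigenspace_iff, ad, LinearMap.sub_apply, LinearMap.mulLeft_apply,
    LinearMap.mulRight_apply, mul_assoc _ _ Y, component_mul h hY, mul_smul_comm, mul_assoc _ f,
    ← mul_assoc Y, mul_component h hY, smul_mul_assoc, sub_smul]

variable [FiniteDimensional ℂ X]

theorem mem_iSup_eigenspace_ad (h : DirectSum.IsInternal I)
    (hY : ∀ i, ∀ x ∈ I i, Y x = w i • x) {Λ : Set ℂ}
    (hf : ∀ i, ∀ x ∈ I i, f x ∈ sumOver I {j | w j - w i ∈ Λ}) :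
    f ∈ ⨆ μ ∈ Λ, Module.End.eigenspace (ad Y) μ := by
  have hfin := WellFoundedGT.finite_ne_bot_of_iSupIndep h.submodule_iSupIndep
  have hsum : ∑ i ∈ hfin.toFinset, component h {i} = 1 :=
    sum_component h fun i hi => by simpa using hi
  have hf_sum : f = ∑ i ∈ hfin.toFinset, ∑ j ∈ hfin.toFinset,
      component h {j} * f * component h {i} := by
    simp only [← Finset.mul_sum, ← Finset.sum_mul, hsum, one_mul, mul_one]
  rw [hf_sum]
  refine Submodule.sum_mem _ fun i _ => Submodule.sum_mem _ fun j _ => ?_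
  by_cases hij : w j - w i ∈ Λ
  · exact Submodule.mem_iSup_of_mem _ (Submodule.mem_iSup_of_mem hij
      (component_mul_component_mem_eigenspace_ad h hY f i j))
  · have hzero : component h {j} * f * component h {i} = 0 := LinearMap.ext fun x => by
      have hx : component h {i} x ∈ I i := sumOver_singleton (I := I) i ▸ component_mem h {i} x
      refine (component_eq_zero_iff h).2 (sumOver_mono ?_ (hf i _ hx))
      rintro k hk rfl
      exact hij hk
    exact hzero ▸ Submodule.zero_mem _

theorem isCompl_eigenspace_ad (h : DirectSum.IsInternal I)
    (hY : ∀ i, ∀ x ∈ I i, Y x = w i • x) :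
    IsCompl (Module.End.eigenspace (ad Y) 0)
      (⨆ (μ : ℂ) (_ : μ ≠ 0), Module.End.eigenspace (ad Y) μ) where
  disjoint := Module.End.eigenspaces_iSupIndep (ad Y) 0
  codisjoint := by
    rw [codisjoint_iff, ← iSup_split_single, eq_top_iff]
    intro f _
    have huniv : ∀ i, ∀ x ∈ I i, f x ∈ sumOver I {j | w j - w i ∈ Set.univ} := fun i x _ =>
      (sumOver_univ h).ge Submodule.mem_top
    simpa only [Set.mem_univ, iSup_true] using mem_iSup_eigenspace_ad h hY huniv

theorem adWeightZero_eq (h : DirectSum.IsInternal I) (hY : ∀ i, ∀ x ∈ I i, Y x = w i • x)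
    (hg : ∀ i, ∀ x ∈ I i, g x ∈ sumOver I {j | w j = w i})
    (hfg : ∀ i, ∀ x ∈ I i, f x - g x ∈ sumOver I {j | w j ≠ w i}) :
    adWeightZero Y f = g := by
  have hg₀ : g ∈ Module.End.eigenspace (ad Y) 0 := by
    simpa using mem_iSup_eigenspace_ad (Λ := {0}) h hY (by simpa [sub_eq_zero] using hg)
  have hfg₀ : f - g ∈ ⨆ (μ : ℂ) (_ : μ ≠ 0), Module.End.eigenspace (ad Y) μ :=
    mem_iSup_eigenspace_ad (Λ := {0}ᶜ) h hY (by simpa [sub_eq_zero] using hfg)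
  rw [adWeightZero, dif_pos (isCompl_eigenspace_ad h hY), ← add_sub_cancel g f, map_add,
    Submodule.projection_apply_of_mem_left _ hg₀,
    (Submodule.projection_apply_eq_zero_iff _).2 hfg₀, add_zero]

end AdEigenspaces

section GradingOf

variable {V : Type*} [AddCommGroup V] [Module ℚ V] {I : ℤ → ℤ → Submodule ℂ (Cx V)}

theorem gradingOf_apply (h : DirectSum.IsInternal fun i : ℤ × ℤ => I i.1 i.2) {i : ℤ × ℤ}
    {x : Cx V} (hx : x ∈ I i.1 i.2) : gradingOf I x = ((i.1 + i.2 : ℤ) : ℂ) • x := by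
  rw [gradingOf, dif_pos h]
  exact glue_apply h (fun i => ((i.1 + i.2 : ℤ) : ℂ) • (I i.1 i.2).subtype) hx

end GradingOf

section ConnectionPair

variable {R X : Type*} [Ring R] [AddCommGroup X] [Module R X] {ν : R →+* R}
  {c : X →ₛₗ[ν] X} {W F : ℤ → Submodule R X} {I : ℤ × ℤ → Submodule R X}
  {f α β : Module.End R X} {d : ℤ}

namespace IsBigrading

theorem le_sumOver_below_sup_conj_F_inf_W (h : IsBigrading c W F I) (p q : ℤ) :
    I (p, q) ≤ sumOver I (below p q) ⊔ (F q).comap c ⊓ W (p + q) := by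
  rw [← sup_inf_assoc_of_le _ (h.sumOver_below_le_W (by omega)), sup_comm]
  exact le_inf (h.le_conj_F_sup p q) (h.le_W p q)

theorem monotone_iSup_conj_F_inf_W (h : IsBigrading c W F I) :
    Monotone fun p => ⨆ k, (F (k - p)).comap c ⊓ W k := fun _ _ hpq =>
  iSup_mono fun _ => inf_le_inf_right _ (Submodule.comap_mono (h.F_antitone (by omega)))

theorem le_iSup_conj_F_inf_W (h : IsBigrading c W F I) {k₀ : ℤ} (hk₀ : W k₀ = ⊥) (p q : ℤ) :
    I (p, q) ≤ ⨆ k, (F (k - p)).comap c ⊓ W k := by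
  rcases le_or_gt (p + q) k₀ with hpq | _
  · have hbot : I (p, q) ≤ W k₀ := by
      rw [h.W_eq]
      exact le_sumOver hpq
    exact hbot.trans (hk₀ ▸ bot_le)
  · refine (h.le_sumOver_below_sup_conj_F_inf_W p q).trans (sup_le (sumOver_le fun i hi => ?_) ?_)
    · exact (h.le_iSup_conj_F_inf_W hk₀ i.1 i.2).trans (h.monotone_iSup_conj_F_inf_W hi.1.le)
    · refine le_iSup_of_le (p + q) (inf_le_inf_right _ ?_)
      rw [add_sub_cancel_left]
termination_by (p + q - k₀).toNat
decreasing_by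
  have := mem_below.1 hi
  omega

theorem sumOver_fst_le_eq_iSup (h : IsBigrading c W F I) (p : ℤ) :
    sumOver I {i | i.1 ≤ p} = ⨆ k, (F (k - p)).comap c ⊓ W k := by
  obtain ⟨k₀, hk₀⟩ := h.exists_W_eq_bot
  refine le_antisymm (sumOver_le fun i hi => ?_) (iSup_le fun k => ?_)
  · exact (h.le_iSup_conj_F_inf_W hk₀ i.1 i.2).trans (h.monotone_iSup_conj_F_inf_W hi)
  · exact (h.conj_F_inf_W_le (k - p) k).trans (sumOver_mono (by grind))

end IsBigrading

variable [RingHomInvPair ν ν]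

/-- The conjugate `c ∘ f ∘ c` of an endomorphism `f` with respect to the conjugation `c`. -/
def conjOf (c : X →ₛₗ[ν] X) (f : Module.End R X) : Module.End R X :=
  c.comp (f.comp c)

theorem conjOf_apply (f : Module.End R X) (x : X) : conjOf c f x = c (f (c x)) := rfl

namespace IsBigrading

theorem conj_F_inf_W_le_comap_conjOf (h : IsBigrading c W F I)
    (hF : ∀ p, F p ≤ (F (p - d)).comap f) (hW : ∀ k, W k ≤ (W k).comap f) (q k : ℤ) :
    (F q).comap c ⊓ W k ≤ ((F (q - d)).comap c ⊓ W k).comap (conjOf c f) := by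
  rintro x ⟨hxF, hxW⟩
  refine ⟨?_, h.W_le_comap k (hW k (h.W_le_comap k hxW))⟩
  rw [SetLike.mem_coe, Submodule.mem_comap, conjOf_apply, h.involutive]
  exact hF q hxF

theorem sumOver_fst_le_le_comap_conjOf (h : IsBigrading c W F I)
    (hF : ∀ p, F p ≤ (F (p - d)).comap f) (hW : ∀ k, W k ≤ (W k).comap f) (p : ℤ) :
    sumOver I {i | i.1 ≤ p} ≤ (sumOver I {i | i.1 ≤ p + d}).comap (conjOf c f) := by
  simp only [h.sumOver_fst_le_eq_iSup]
  refine iSup_le fun k => (h.conj_F_inf_W_le_comap_conjOf hF hW _ _).trans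
    (Submodule.comap_mono (le_iSup_of_le k ?_))
  rw [sub_sub]

theorem le_comap_conjOf_insert (h : IsBigrading c W F I)
    (hf : ∀ p q, I (p, q) ≤
      (sumOver I (insert (p + d, q - d) {i | i.1 + i.2 < p + q})).comap f) (p q : ℤ) :
    I (p, q) ≤ (sumOver I (insert (p - d, q + d) {i | i.1 + i.2 < p + q})).comap (conjOf c f) := by
  have hf' : sumOver I (insert (q, p) (below q p)) ≤
      (sumOver I (insert (q + d, p - d) {i | i.1 + i.2 < p + q})).comap f :=
    sumOver_le fun i hi => (hf i.1 i.2).trans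
      (Submodule.comap_mono (sumOver_mono (by grind [below])))
  intro x hx
  exact h.sumOver_le_comap (fun r s hrs => by grind [below]) (hf' (h.le_comap p q hx))

end IsBigrading

/-- The linear-algebraic properties, at a point of `S` and for a tangent vector `ξ`, of the values
`α` at `ξ^{0,1}` and `β` at `ξ^{1,0}` of the connection form of a real connection for which `W` is
flat and `F` is holomorphic and horizontal. The form is taken in a frame compatible with `I`; such
a frame is not real, so conjugation changes the form by an endomorphism of the type described in
`sub_conjOf`. -/
structure IsConnectionPair (c : X →ₛₗ[ν] X) (W F : ℤ → Submodule R X)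
    (I : ℤ × ℤ → Submodule R X) (α β : Module.End R X) : Prop where
  isBigrading : IsBigrading c W F I
  sub_conjOf : ∀ p q, sumOver I (insert (p, q) (below p q)) ≤
    (sumOver I (insert (p, q) (below p q))).comap (α - conjOf c β)
  F_le_left : ∀ p, F p ≤ (F p).comap α
  F_le_right : ∀ p, F p ≤ (F (p - 1)).comap β
  W_le_left : ∀ k, W k ≤ (W k).comap α
  W_le_right : ∀ k, W k ≤ (W k).comap β

namespace IsConnectionPair

theorem le_comap_left_sub_conjOf (h : IsConnectionPair c W F I α β) (p q : ℤ) :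
    I (p, q) ≤ (sumOver I (insert (p, q) (below p q))).comap (α - conjOf c β) :=
  (le_sumOver (Set.mem_insert _ _)).trans (h.sub_conjOf p q)

theorem le_comap_right_sub_conjOf (h : IsConnectionPair c W F I α β) (p q : ℤ) :
    I (p, q) ≤ (sumOver I (insert (p, q) (below p q))).comap (β - conjOf c α) := by
  intro x hx
  have hcx := h.sub_conjOf q p (h.isBigrading.le_comap p q hx)
  have hccx : c ((α - conjOf c β) (c x)) ∈ sumOver I (insert (p, q) (below p q)) :=
    h.isBigrading.sumOver_le_comap (fun r s hrs => by grind [below]) hcx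
  rw [LinearMap.sub_apply, map_sub, conjOf_apply, h.isBigrading.involutive,
    h.isBigrading.involutive] at hccx
  rw [Submodule.mem_comap, LinearMap.sub_apply, conjOf_apply, ← neg_sub]
  exact Submodule.neg_mem _ hccx

theorem le_comap_conjOf_left (h : IsConnectionPair c W F I α β) (p q : ℤ) :
    I (p, q) ≤ (sumOver I {i | i.1 ≤ p}).comap (conjOf c α) := by
  have hα := h.isBigrading.sumOver_fst_le_le_comap_conjOf (d := 0)
    (by simpa only [sub_zero] using h.F_le_left) h.W_le_left p
  rw [add_zero] at hα
  exact fun x hx => hα (le_sumOver (i := (p, q)) (le_refl p) hx)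

theorem le_comap_conjOf_right (h : IsConnectionPair c W F I α β) (p q : ℤ) :
    I (p, q) ≤ (sumOver I (insert (p + 1, q - 1) {i | i.1 ≤ p})).comap (conjOf c β) := by
  refine (h.isBigrading.le_sumOver_below_sup_conj_F_inf_W p q).trans (sup_le ?_ ?_)
  · have hβ := h.isBigrading.sumOver_fst_le_le_comap_conjOf h.F_le_right h.W_le_right (p - 1)
    exact (sumOver_mono (by grind [below])).trans
      (hβ.trans (Submodule.comap_mono (sumOver_mono (by grind))))
  · refine (h.isBigrading.conj_F_inf_W_le_comap_conjOf h.F_le_right h.W_le_right q _).trans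
      (Submodule.comap_mono ?_)
    exact (h.isBigrading.conj_F_inf_W_le (q - 1) _).trans (sumOver_mono (by grind))

theorem le_comap_left (h : IsConnectionPair c W F I α β) (p q : ℤ) :
    I (p, q) ≤
      (sumOver I (insert (p + 1, q - 1) {i | i.1 = p ∧ i.1 + i.2 ≤ p + q})).comap α := by
  intro x hx
  have hF : α x ∈ F p := h.F_le_left p (h.isBigrading.le_F p q hx)
  have hW : α x ∈ W (p + q) := h.W_le_left _ (h.isBigrading.le_W p q hx)
  have hfst : α x ∈ sumOver I (insert (p + 1, q - 1) {i | i.1 ≤ p}) := by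
    rw [← sub_add_cancel (α x) (conjOf c β x)]
    exact Submodule.add_mem _ (sumOver_mono (by grind [below]) (h.le_comap_left_sub_conjOf p q hx))
      (h.le_comap_conjOf_right p q hx)
  rw [h.isBigrading.F_eq] at hF
  rw [h.isBigrading.W_eq] at hW
  have hinf := Submodule.mem_inf.2 ⟨hF, Submodule.mem_inf.2 ⟨hW, hfst⟩⟩
  rw [sumOver_inf_sumOver h.isBigrading.indep, sumOver_inf_sumOver h.isBigrading.indep] at hinf
  exact sumOver_mono (by grind) hinf

theorem le_comap_right (h : IsConnectionPair c W F I α β) (p q : ℤ) :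
    I (p, q) ≤ (sumOver I {i | p - 1 ≤ i.1 ∧ i.1 ≤ p ∧ i.1 + i.2 ≤ p + q}).comap β := by
  intro x hx
  have hF : β x ∈ F (p - 1) := h.F_le_right p (h.isBigrading.le_F p q hx)
  have hW : β x ∈ W (p + q) := h.W_le_right _ (h.isBigrading.le_W p q hx)
  have hfst : β x ∈ sumOver I {i | i.1 ≤ p} := by
    rw [← sub_add_cancel (β x) (conjOf c α x)]
    exact Submodule.add_mem _
      (sumOver_mono (by grind [below]) (h.le_comap_right_sub_conjOf p q hx))
      (h.le_comap_conjOf_left p q hx)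
  rw [h.isBigrading.F_eq] at hF
  rw [h.isBigrading.W_eq] at hW
  have hinf := Submodule.mem_inf.2 ⟨hF, Submodule.mem_inf.2 ⟨hfst, hW⟩⟩
  rwa [sumOver_inf_sumOver h.isBigrading.indep, sumOver_inf_sumOver h.isBigrading.indep] at hinf

end IsConnectionPair

end ConnectionPair

section Shift

variable {R X : Type*} [CommRing R] [AddCommGroup X] [Module R X]
  {I : ℤ × ℤ → Submodule R X} {A : Set (ℤ × ℤ)} {i : ℤ × ℤ}

/-- The part of an endomorphism that maps `⨁_q I^{p,q}` to `⨁_q I^{p+d,q}` for all `p`. -/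
def shift (hI : DirectSum.IsInternal I) (d : ℤ) : Module.End R X →ₗ[R] Module.End R X where
  toFun f := glue hI fun i => component hI {j | j.1 = i.1 + d} ∘ₗ f ∘ₗ (I i).subtype
  map_add' f g := linearMap_ext_of_isInternal hI fun i x hx => by
    simp only [LinearMap.add_apply, glue_apply hI _ hx, LinearMap.comp_apply, map_add]
  map_smul' z f := linearMap_ext_of_isInternal hI fun i x hx => by
    simp only [LinearMap.smul_apply, glue_apply hI _ hx, LinearMap.comp_apply, map_smul,
      RingHom.id_apply]

theorem shift_apply (hI : DirectSum.IsInternal I) (d : ℤ) (f : Module.End R X) {x : X}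
    (hx : x ∈ I i) : shift hI d f x = component hI {j | j.1 = i.1 + d} (f x) :=
  glue_apply hI _ hx

theorem sumOver_fst_eq_le_comap_shift (hI : DirectSum.IsInternal I) (d : ℤ) (f : Module.End R X)
    (p : ℤ) : sumOver I {i | i.1 = p} ≤ (sumOver I {i | i.1 = p + d}).comap (shift hI d f) := by
  refine sumOver_le ?_
  rintro i rfl x hx
  rw [Submodule.mem_comap, shift_apply hI d f hx]
  exact component_mem hI _ _

theorem le_comap_shift (hI : DirectSum.IsInternal I) (d : ℤ) {f : Module.End R X}
    (hf : I i ≤ (sumOver I A).comap f) :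
    I i ≤ (sumOver I (A ∩ {j | j.1 = i.1 + d})).comap (shift hI d f) := fun x hx => by
  rw [Submodule.mem_comap, shift_apply hI d f hx]
  exact component_mem_inter hI _ (hf hx)

theorem le_comap_sub_shift (hI : DirectSum.IsInternal I) (d : ℤ) {f : Module.End R X}
    (hf : I i ≤ (sumOver I A).comap f) :
    I i ≤ (sumOver I (A \ {j | j.1 = i.1 + d})).comap (f - shift hI d f) := fun x hx => by
  rw [Submodule.mem_comap, LinearMap.sub_apply, shift_apply hI d f hx]
  exact sub_component_mem hI _ (hf hx)

namespace IsConnectionPair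

variable {ν : R →+* R} [RingHomInvPair ν ν] {c : X →ₛₗ[ν] X} {W F : ℤ → Submodule R X}
  {α β : Module.End R X}

theorem le_comap_shift_left (h : IsConnectionPair c W F I α β) (hI : DirectSum.IsInternal I)
    (p q : ℤ) : I (p, q) ≤ (I (p + 1, q - 1)).comap (shift hI 1 α) := by
  rw [← sumOver_singleton (I := I) (p + 1, q - 1)]
  exact (le_comap_shift hI 1 (h.le_comap_left p q)).trans
    (Submodule.comap_mono (sumOver_mono (by grind)))

theorem le_comap_left_sub_shift (h : IsConnectionPair c W F I α β) (hI : DirectSum.IsInternal I)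
    (p q : ℤ) :
    I (p, q) ≤ (sumOver I {i | i.1 = p ∧ i.1 + i.2 ≤ p + q}).comap (α - shift hI 1 α) :=
  (le_comap_sub_shift hI 1 (h.le_comap_left p q)).trans
    (Submodule.comap_mono (sumOver_mono (by grind)))

theorem le_comap_shift_right (h : IsConnectionPair c W F I α β) (hI : DirectSum.IsInternal I)
    (p q : ℤ) :
    I (p, q) ≤ (sumOver I {i | i.1 = p - 1 ∧ i.1 + i.2 ≤ p + q}).comap (shift hI (-1) β) :=
  (le_comap_shift hI (-1) (h.le_comap_right p q)).trans
    (Submodule.comap_mono (sumOver_mono (by grind)))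

theorem le_comap_right_sub_shift (h : IsConnectionPair c W F I α β) (hI : DirectSum.IsInternal I)
    (p q : ℤ) :
    I (p, q) ≤ (sumOver I {i | i.1 = p ∧ i.1 + i.2 ≤ p + q}).comap (β - shift hI (-1) β) :=
  (le_comap_sub_shift hI (-1) (h.le_comap_right p q)).trans
    (Submodule.comap_mono (sumOver_mono (by grind)))

theorem sumOver_fst_eq_le_comap_left_sub_shift (h : IsConnectionPair c W F I α β)
    (hI : DirectSum.IsInternal I) (p : ℤ) :
    sumOver I {i | i.1 = p} ≤ (sumOver I {i | i.1 = p}).comap (α - shift hI 1 α) :=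
  sumOver_le fun i hi => (h.le_comap_left_sub_shift hI i.1 i.2).trans
    (Submodule.comap_mono (sumOver_mono (by grind)))

theorem sumOver_fst_eq_le_comap_right_sub_shift (h : IsConnectionPair c W F I α β)
    (hI : DirectSum.IsInternal I) (p : ℤ) :
    sumOver I {i | i.1 = p} ≤ (sumOver I {i | i.1 = p}).comap (β - shift hI (-1) β) :=
  sumOver_le fun i hi => (h.le_comap_right_sub_shift hI i.1 i.2).trans
    (Submodule.comap_mono (sumOver_mono (by grind)))

theorem le_comap_conjOf_shift_right (h : IsConnectionPair c W F I α β)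
    (hI : DirectSum.IsInternal I) (p q : ℤ) :
    I (p, q) ≤ (sumOver I (insert (p + 1, q - 1) {i | i.1 + i.2 < p + q})).comap
      (conjOf c (shift hI (-1) β)) :=
  (h.isBigrading.le_comap_conjOf_insert (d := -1) (fun p q => (h.le_comap_shift_right hI p q).trans
    (Submodule.comap_mono (sumOver_mono (by grind)))) p q).trans
    (Submodule.comap_mono (sumOver_mono (by grind)))

theorem le_comap_conjOf_right_sub_shift (h : IsConnectionPair c W F I α β)
    (hI : DirectSum.IsInternal I) (p q : ℤ) :
    I (p, q) ≤ (sumOver I (insert (p, q) {i | i.1 + i.2 < p + q})).comap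
      (conjOf c (β - shift hI (-1) β)) :=
  (h.isBigrading.le_comap_conjOf_insert (d := 0)
    (fun p q => (h.le_comap_right_sub_shift hI p q).trans
      (Submodule.comap_mono (sumOver_mono (by grind)))) p q).trans
    (Submodule.comap_mono (sumOver_mono (by grind)))

theorem le_comap_conjOf_shift_sub_shift (h : IsConnectionPair c W F I α β)
    (hI : DirectSum.IsInternal I) (p q : ℤ) :
    I (p, q) ≤ (sumOver I {i | i.1 + i.2 < p + q}).comap
      (conjOf c (shift hI (-1) β) - shift hI 1 α) := by
  intro x hx
  have hshift : (conjOf c (shift hI (-1) β) - shift hI 1 α) x ∈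
      sumOver I (insert (p + 1, q - 1) {i | i.1 + i.2 < p + q}) :=
    Submodule.sub_mem _ (h.le_comap_conjOf_shift_right hI p q hx)
      (le_sumOver (Set.mem_insert _ _) (h.le_comap_shift_left hI p q hx))
  have heq : (conjOf c (shift hI (-1) β) - shift hI 1 α) x = (α - shift hI 1 α) x -
      (α - conjOf c β) x - conjOf c (β - shift hI (-1) β) x := by
    simp only [conjOf_apply, LinearMap.sub_apply, map_sub]
    abel
  have hrest : (conjOf c (shift hI (-1) β) - shift hI 1 α) x ∈
      sumOver I (insert (p, q) {i | i.1 + i.2 < p + q}) := by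
    rw [heq]
    exact Submodule.sub_mem _ (Submodule.sub_mem _
      (sumOver_mono (by grind -funext) (h.le_comap_left_sub_shift hI p q hx))
      (sumOver_mono (by grind -funext [below]) (h.le_comap_left_sub_conjOf p q hx)))
      (h.le_comap_conjOf_right_sub_shift hI p q hx)
  have hinf := Submodule.mem_inf.2 ⟨hshift, hrest⟩
  rw [sumOver_inf_sumOver h.isBigrading.indep] at hinf
  exact sumOver_mono (by grind -funext) hinf

end IsConnectionPair

end Shift

section AdWeightZero

variable {X : Type*} [AddCommGroup X] [Module ℂ X] [FiniteDimensional ℂ X] {ν : ℂ →+* ℂ}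
  [RingHomInvPair ν ν] {c : X →ₛₗ[ν] X} {W F : ℤ → Submodule ℂ X} {I : ℤ × ℤ → Submodule ℂ X}
  {Y α β : Module.End ℂ X}

theorem IsConnectionPair.adWeightZero_conjOf_shift (h : IsConnectionPair c W F I α β)
    (hI : DirectSum.IsInternal I)
    (hY : ∀ i : ℤ × ℤ, ∀ x ∈ I i, Y x = ((i.1 + i.2 : ℤ) : ℂ) • x) :
    adWeightZero Y (conjOf c (shift hI (-1) β)) = shift hI 1 α := by
  refine adWeightZero_eq hI hY (fun i x hx => ?_) (fun i x hx => ?_)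
  · exact le_sumOver (by simp) (h.le_comap_shift_left hI i.1 i.2 hx)
  · refine sumOver_mono (fun j hj => ?_) (h.le_comap_conjOf_shift_sub_shift hI i.1 i.2 hx)
    exact Int.cast_injective.ne (ne_of_lt hj)

end AdWeightZero

section TypeDecomposition

variable {X M : Type*} [AddCommGroup X] [Module ℂ X] [AddCommGroup M] [Module ℂ M]
  (A : X →ₗ[ℝ] M)

theorem map_complex_smul (z : ℂ) (x : X) :
    A (z • x) = (z.re : ℂ) • A x + (z.im : ℂ) • A (Complex.I • x) := by
  conv_lhs => rw [← Complex.re_add_im z]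
  simp only [add_smul, mul_smul, Complex.coe_smul, map_add, map_smul]

/-- The conjugate-linear part of a real-linear map between complex vector spaces. -/
def antilinearPart : X →ₛₗ[starRingEnd ℂ] M where
  toFun x := (1 / 2 : ℂ) • (A x + Complex.I • A (Complex.I • x))
  map_add' x y := by
    simp only [map_add, smul_add]
    abel
  map_smul' z x := by
    have hconj : starRingEnd ℂ z = z.re - z.im * Complex.I := by
      apply Complex.ext <;> simp
    rw [smul_smul Complex.I z, map_complex_smul, map_complex_smul A (Complex.I * z), hconj]
    generalize A x = a
    generalize A (Complex.I • x) = b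
    simp only [Complex.I_mul_re, Complex.I_mul_im, Complex.ofReal_neg]
    match_scalars
    · ring
    · linear_combination (1 / 2 * (z.im : ℂ)) * Complex.I_sq

/-- The complex-linear part of a real-linear map between complex vector spaces. -/
def linearPart : X →ₗ[ℂ] M where
  toFun x := (1 / 2 : ℂ) • (A x - Complex.I • A (Complex.I • x))
  map_add' x y := by
    simp only [map_add, smul_add]
    module
  map_smul' z x := by
    rw [smul_smul Complex.I z, map_complex_smul, map_complex_smul A (Complex.I * z),
      RingHom.id_apply]
    conv_rhs => rw [← Complex.re_add_im z]
    generalize A x = a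
    generalize A (Complex.I • x) = b
    simp only [Complex.I_mul_re, Complex.I_mul_im, Complex.ofReal_neg]
    match_scalars
    · ring
    · linear_combination (1 / 2 * (z.im : ℂ)) * Complex.I_sq

end TypeDecomposition

section ConnectionForm

namespace VGPMHS.LocalFrame

variable {E : Type*} [NormedAddCommGroup E] [NormedSpace ℂ E]
  {S : Type*} [TopologicalSpace S] [ChartedSpace E S] {𝒱 : VGPMHS E S} {s₀ : S}
  (φ : 𝒱.LocalFrame s₀)

theorem le_comap_connection_sub_conjOf (ξ : E) (p q : ℤ) :
    sumOver (𝒱.bigrading s₀) (insert (p, q) (below p q)) ≤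
      (sumOver (𝒱.bigrading s₀) (insert (p, q) (below p q))).comap
        (φ.connection ξ - conjOf (conj _) (φ.connection ξ)) := by
  have conj_mem : ∀ s (x : 𝒱.fiberC s) p q,
      x ∈ sumOver (𝒱.bigrading s) (insert (p, q) (below p q)) →
        conj _ x ∈ sumOver (𝒱.bigrading s) (insert (q, p) (below q p)) := fun s x p q hx =>
    (𝒱.isBigrading s).sumOver_le_comap (fun r t hrt => by grind [below]) hx
  intro v hv
  obtain ⟨N, hN, hs₀, σ, hσ, hσv, hσA⟩ := φ.exists_section (conj _ v)
  have hσN : ∀ᶠ s in 𝓝 s₀, σ s ∈ sumOver (𝒱.bigrading s) (insert (q, p) (below q p)) :=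
    (hN.eventually_mem hs₀).mono fun s hs => hσA s hs _ (conj_mem _ _ p q hv)
  have hnabla := φ.nabla_sub_connection_mem (hσ s₀ hs₀) hσN ξ
  have hnabla_conj := φ.nabla_sub_connection_mem (RationalLocalSystem.IsSmoothAt.conj (hσ s₀ hs₀))
    (hσN.mono fun s hs => conj_mem _ _ q p hs) ξ
  have hconj_nabla := conj_mem _ _ q p hnabla
  rw [RationalLocalSystem.nabla_conj (hσ s₀ hs₀), hσv, conj_conj] at hnabla_conj
  rw [hσv, map_sub] at hconj_nabla
  have hsub := Submodule.sub_mem _ hconj_nabla hnabla_conj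
  rwa [sub_sub_sub_cancel_left] at hsub

theorem W_le_comap_connection (ξ : E) (k : ℤ) :
    (𝒱.W s₀ k).baseChange ℂ ≤ ((𝒱.W s₀ k).baseChange ℂ).comap (φ.connection ξ) := by
  have hW : ∀ s, (𝒱.W s k).baseChange ℂ = sumOver (𝒱.bigrading s) {i | i.1 + i.2 ≤ k} := fun s =>
    (𝒱.isBigrading s).W_eq k
  intro v hv
  obtain ⟨N, hN, hs₀, σ, hσ, rfl, hσA⟩ := φ.exists_section v
  have hσW : ∀ᶠ s in 𝓝 s₀, σ s ∈ sumOver (𝒱.bigrading s) {i | i.1 + i.2 ≤ k} :=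
    (hN.eventually_mem hs₀).mono fun s hs => hσA s hs _ (hW s₀ ▸ hv)
  have hnabla : 𝒱.nabla σ s₀ ξ ∈ (𝒱.W s₀ k).baseChange ℂ := by
    refine RationalLocalSystem.nabla_mem_of_flat (hσ s₀ hs₀) ?_ ξ
    filter_upwards [hσW, 𝒱.eventually_map_W s₀] with s hs hmap
    rw [← hW] at hs
    exact hmap k ▸ Submodule.mem_map_of_mem hs
  have hsub := φ.nabla_sub_connection_mem (hσ s₀ hs₀) hσW ξ
  rw [← hW] at hsub
  exact (Submodule.sub_mem_iff_right _ hnabla).1 hsub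

/-- The value at `ξ^{0,1}` of the connection form relative to a local frame. -/
def connection01 : E →ₛₗ[starRingEnd ℂ] Module.End ℂ (𝒱.fiberC s₀) :=
  antilinearPart φ.connection

/-- The value at `ξ^{1,0}` of the connection form relative to a local frame. -/
def connection10 : E →ₗ[ℂ] Module.End ℂ (𝒱.fiberC s₀) :=
  linearPart φ.connection

theorem connection01_apply (ξ : E) (v : 𝒱.fiberC s₀) : φ.connection01 ξ v =
    (1 / 2 : ℂ) • (φ.connection ξ v + Complex.I • φ.connection (Complex.I • ξ) v) := rfl

theorem connection10_apply (ξ : E) (v : 𝒱.fiberC s₀) : φ.connection10 ξ v =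
    (1 / 2 : ℂ) • (φ.connection ξ v - Complex.I • φ.connection (Complex.I • ξ) v) := rfl

theorem nabla01_sub_connection01_mem {σ : 𝒱.Sec} (hσ : 𝒱.IsSmoothAt E σ s₀) {A : Set (ℤ × ℤ)}
    (hA : ∀ᶠ s in 𝓝 s₀, σ s ∈ sumOver (𝒱.bigrading s) A) (ξ : E) :
    𝒱.nabla01 σ s₀ ξ - φ.connection01 ξ (σ s₀) ∈ sumOver (𝒱.bigrading s₀) A := by
  have hsub := fun ξ => φ.nabla_sub_connection_mem hσ hA ξ
  convert Submodule.smul_mem _ (1 / 2 : ℂ)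
    (Submodule.add_mem _ (hsub ξ) (Submodule.smul_mem _ Complex.I (hsub (Complex.I • ξ)))) using 1
  rw [connection01_apply, RationalLocalSystem.nabla01]
  module

theorem nabla10_sub_connection10_mem {σ : 𝒱.Sec} (hσ : 𝒱.IsSmoothAt E σ s₀) {A : Set (ℤ × ℤ)}
    (hA : ∀ᶠ s in 𝓝 s₀, σ s ∈ sumOver (𝒱.bigrading s) A) (ξ : E) :
    𝒱.nabla10 σ s₀ ξ - φ.connection10 ξ (σ s₀) ∈ sumOver (𝒱.bigrading s₀) A := by
  have hsub := fun ξ => φ.nabla_sub_connection_mem hσ hA ξ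
  convert Submodule.smul_mem _ (1 / 2 : ℂ)
    (Submodule.sub_mem _ (hsub ξ) (Submodule.smul_mem _ Complex.I (hsub (Complex.I • ξ)))) using 1
  rw [connection10_apply, RationalLocalSystem.nabla10]
  module

theorem exists_holomorphic_span_F (p : ℤ) (s₀ : S) : ∃ N : Set S, IsOpen N ∧ s₀ ∈ N ∧
    ∃ (m : ℕ) (e : Fin m → 𝒱.Sec), (∀ j, 𝒱.IsHolomorphicOn E (e j) N) ∧
      (∀ j, ∀ s ∈ N, e j s ∈ 𝒱.F s p) ∧
      𝒱.F s₀ p = Submodule.span ℂ (Set.range fun j => e j s₀) := by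
  obtain ⟨N, hN, hs₀, m, e, he, hspan⟩ := 𝒱.holomorphic_F p s₀
  exact ⟨N, hN, hs₀, m, e, he,
    fun j s hs => (hspan s hs).2.le (Submodule.subset_span (Set.mem_range_self j)),
    (hspan s₀ hs₀).2.symm⟩

theorem F_le_comap_connection01 (ξ : E) (p : ℤ) :
    𝒱.F s₀ p ≤ (𝒱.F s₀ p).comap (φ.connection01 ξ) := by
  obtain ⟨N, hN, hs₀, m, e, he, heF, hspan⟩ := exists_holomorphic_span_F (𝒱 := 𝒱) p s₀
  conv_lhs => rw [hspan]
  refine Submodule.span_le.2 (Set.range_subset_iff.2 fun j => ?_)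
  have hsub := φ.nabla01_sub_connection01_mem ((he j).1 s₀ hs₀)
    ((hN.eventually_mem hs₀).mono fun s hs => (𝒱.isBigrading s).F_eq p ▸ heF j s hs) ξ
  rwa [← (𝒱.isBigrading s₀).F_eq, (he j).2 s₀ hs₀, zero_sub, Submodule.neg_mem_iff] at hsub

theorem F_le_comap_connection10 (ξ : E) (p : ℤ) :
    𝒱.F s₀ p ≤ (𝒱.F s₀ (p - 1)).comap (φ.connection10 ξ) := by
  obtain ⟨N, hN, hs₀, m, e, he, heF, hspan⟩ := exists_holomorphic_span_F (𝒱 := 𝒱) p s₀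
  rw [hspan]
  refine Submodule.span_le.2 (Set.range_subset_iff.2 fun j => ?_)
  have hsub := φ.nabla10_sub_connection10_mem ((he j).1 s₀ hs₀)
    ((hN.eventually_mem hs₀).mono fun s hs => (𝒱.isBigrading s).F_eq p ▸ heF j s hs) ξ
  rw [← (𝒱.isBigrading s₀).F_eq] at hsub
  have hhor := 𝒱.horizontal p N hN (e j) (he j) (heF j) s₀ hs₀
  have hnabla : 𝒱.nabla10 (e j) s₀ ξ ∈ 𝒱.F s₀ (p - 1) :=
    Submodule.smul_mem _ _ (Submodule.sub_mem _ (hhor ξ) (Submodule.smul_mem _ _ (hhor _)))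
  exact (Submodule.sub_mem_iff_right _ hnabla).1
    ((𝒱.isBigrading s₀).F_antitone (by omega) hsub)

theorem le_comap_connection01_sub_conjOf (ξ : E) (p q : ℤ) :
    sumOver (𝒱.bigrading s₀) (insert (p, q) (below p q)) ≤
      (sumOver (𝒱.bigrading s₀) (insert (p, q) (below p q))).comap
        (φ.connection01 ξ - conjOf (conj _) (φ.connection10 ξ)) := by
  intro v hv
  have hsub : ∀ ξ, (φ.connection ξ - conjOf (conj _) (φ.connection ξ)) v ∈
      sumOver (𝒱.bigrading s₀) (insert (p, q) (below p q)) := fun ξ =>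
    φ.le_comap_connection_sub_conjOf ξ p q hv
  have hsplit : (φ.connection01 ξ - conjOf (conj _) (φ.connection10 ξ)) v =
      (1 / 2 : ℂ) • ((φ.connection ξ - conjOf (conj _) (φ.connection ξ)) v + Complex.I •
        (φ.connection (Complex.I • ξ) - conjOf (conj _) (φ.connection (Complex.I • ξ))) v) := by
    simp only [LinearMap.sub_apply, conjOf_apply, connection01_apply, connection10_apply, map_sub,
      map_smulₛₗ, Complex.conj_I, map_div₀, map_one, map_ofNat]
    module
  rw [Submodule.mem_comap, hsplit]
  exact Submodule.smul_mem _ _ (Submodule.add_mem _ (hsub ξ) (Submodule.smul_mem _ _ (hsub _)))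

theorem W_le_comap_connection01 (ξ : E) (k : ℤ) :
    (𝒱.W s₀ k).baseChange ℂ ≤ ((𝒱.W s₀ k).baseChange ℂ).comap (φ.connection01 ξ) := by
  intro v hv
  rw [Submodule.mem_comap, connection01_apply]
  exact Submodule.smul_mem _ _ (Submodule.add_mem _ (φ.W_le_comap_connection ξ k hv)
    (Submodule.smul_mem _ _ (φ.W_le_comap_connection _ k hv)))

theorem W_le_comap_connection10 (ξ : E) (k : ℤ) :
    (𝒱.W s₀ k).baseChange ℂ ≤ ((𝒱.W s₀ k).baseChange ℂ).comap (φ.connection10 ξ) := by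
  intro v hv
  rw [Submodule.mem_comap, connection10_apply]
  exact Submodule.smul_mem _ _ (Submodule.sub_mem _ (φ.W_le_comap_connection ξ k hv)
    (Submodule.smul_mem _ _ (φ.W_le_comap_connection _ k hv)))

theorem isConnectionPair (ξ : E) :
    IsConnectionPair (conj _) (fun k => (𝒱.W s₀ k).baseChange ℂ) (𝒱.F s₀) (𝒱.bigrading s₀)
      (φ.connection01 ξ) (φ.connection10 ξ) where
  isBigrading := 𝒱.isBigrading s₀
  sub_conjOf := φ.le_comap_connection01_sub_conjOf ξ
  F_le_left := φ.F_le_comap_connection01 ξ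
  F_le_right := φ.F_le_comap_connection10 ξ
  W_le_left := φ.W_le_comap_connection01 ξ
  W_le_right := φ.W_le_comap_connection10 ξ

end VGPMHS.LocalFrame

end ConnectionForm

section AdaptedFrames

variable {E : Type*} [NormedAddCommGroup E] [NormedSpace ℂ E]
  {S : Type*} [TopologicalSpace S] [ChartedSpace E S]

namespace RationalLocalSystem

variable {L : RationalLocalSystem S} {s₀ s : S}

theorem map_chartC_nabla_eq_zero {X : Type*} [NormedAddCommGroup X] [NormedSpace ℂ X] {σ : L.Sec}
    (hs : s ∈ L.dom s₀) (hσ : L.IsSmoothAt E σ s) {π : (Fin (L.rank s₀) → ℂ) →L[ℂ] X} {b : X}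
    (hπ : ∀ᶠ s' in 𝓝 s, π (L.chartC s₀ s' (σ s')) = b) (ξ : E) :
    π (L.chartC s₀ s (L.nabla σ s ξ)) = 0 := by
  have hcomp := tangentDeriv_clm_comp (π.restrictScalars ℝ)
    (((isSmoothAt_iff hs).1 hσ).mdifferentiableAt (by simp))
  have hconst : (fun s' => π.restrictScalars ℝ (L.chartC s₀ s' (σ s'))) =ᶠ[𝓝 s] fun _ => b := hπ
  rw [tangentDeriv_congr hconst, tangentDeriv_const] at hcomp
  rw [chartC_nabla hs hσ]
  exact (DFunLike.congr_fun hcomp ξ).symm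

theorem exists_frame_nabla01_eq_zero_of_mem {U : ∀ s, Submodule ℂ (L.fiberC s)}
    (hU : IsSmoothFamily E (fun s => (U s).map (L.chartC s₀ s)) s₀) :
    ∃ N : Set S, IsOpen N ∧ s₀ ∈ N ∧ ∃ (m : ℕ) (e : Fin m → L.Sec),
      (∀ j, L.IsSmoothOn E (e j) N) ∧
      (∀ s ∈ N, LinearIndependent ℂ (fun j => e j s) ∧
        Submodule.span ℂ (Set.range fun j => e j s) = U s) ∧
      ∀ s ∈ N, ∀ j, ∀ ξ : E, L.nabla01 (e j) s ξ ∈ U s → L.nabla01 (e j) s ξ = 0 := by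
  obtain ⟨π, m, b, f, hf, hframe⟩ := hU.exists_frame
  obtain ⟨N, hN, hNo, hs₀⟩ := eventually_nhds_iff.1 (hframe.and
    ((Filter.eventually_all.2 hf).and ((L.isOpen_dom s₀).eventually_mem (L.mem_dom s₀))))
  have hd : N ⊆ L.dom s₀ := fun s hs => (hN s hs).2.2
  have he : ∀ j, L.IsSmoothOn E (L.sectionOf s₀ (f j)) N := fun j =>
    isSmoothOn_sectionOf hNo hd fun s hs => (hN s hs).2.1 j
  refine ⟨N, hNo, hs₀, m, fun j => L.sectionOf s₀ (f j), he, fun s hs => ?_, fun s hs j ξ hU => ?_⟩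
  · obtain ⟨⟨hindep, hspan, -⟩, -⟩ := hN s hs
    have hcoord : L.chartC s₀ s ∘ (fun j => L.sectionOf s₀ (f j) s) = fun j => f j s :=
      funext fun j => L.chartC_sectionOf _ (hd hs)
    refine ⟨.of_comp (L.chartC s₀ s) (hcoord ▸ hindep),
      Submodule.map_injective_of_injective (L.bijective_chartC (hd hs)).1 ?_⟩
    rw [← hspan, Submodule.map_span, ← Set.range_comp, hcoord]
  · obtain ⟨⟨-, -, -, hinj⟩, -⟩ := hN s hs
    have hπ : ∀ ξ : E, π (L.chartC s₀ s (L.nabla (L.sectionOf s₀ (f j)) s ξ)) = 0 := by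
      refine map_chartC_nabla_eq_zero (hd hs) (he j s hs) (b := b j) ?_
      filter_upwards [hNo.eventually_mem hs] with s' hs'
      rw [L.chartC_sectionOf _ (hd hs'), (hN s' hs').1.2.2.1 j]
    refine (L.bijective_chartC (hd hs)).1 ((hinj _ (Submodule.mem_map_of_mem hU) ?_).trans
      (map_zero _).symm)
    simp only [nabla01, map_smul, map_add, hπ, smul_zero, add_zero]

end RationalLocalSystem

end AdaptedFrames

section Decomposition

namespace VGPMHS

variable {E : Type*} [NormedAddCommGroup E] [NormedSpace ℂ E]
  {S : Type*} [TopologicalSpace S] [ChartedSpace E S] (𝒱 : VGPMHS E S)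

theorem isSmoothFamily_map_U (p : ℤ) (s₀ : S) :
    IsSmoothFamily E (fun s => (𝒱.U p s).map (𝒱.chartC s₀ s)) s₀ := by
  obtain ⟨φ⟩ := 𝒱.nonempty_localFrame s₀
  refine ⟨φ.toFun, φ.isGauge, φ.eventually_map_sumOver.mono fun s hs => ?_⟩
  simp only [U_eq_sumOver, hs]

theorem isSmoothSubbundle_U (p : ℤ) : 𝒱.IsSmoothSubbundle E (𝒱.U p) := fun s₀ => by
  obtain ⟨N, hN, hs₀, m, e, he, hspan, -⟩ :=
    RationalLocalSystem.exists_frame_nabla01_eq_zero_of_mem (𝒱.isSmoothFamily_map_U p s₀)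
  exact ⟨N, hN, hs₀, m, e, he, hspan⟩

theorem isInternal_bigrading (s : S) : DirectSum.IsInternal (𝒱.bigrading s) :=
  (𝒱.isDeligneBigrading s).isInternal

/-- A choice of local frame around `s`. -/
def localFrame (s : S) : 𝒱.LocalFrame s :=
  (𝒱.nonempty_localFrame s).some

theorem nabla01_sub_connection01_mem_U {p : ℤ} {N : Set S} (hN : IsOpen N) {σ : 𝒱.Sec}
    (hσ : 𝒱.IsSmoothOn E σ N) (hU : ∀ s ∈ N, σ s ∈ 𝒱.U p s) {s : S} (hs : s ∈ N) (ξ : E) :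
    𝒱.nabla01 σ s ξ - (𝒱.localFrame s).connection01 ξ (σ s) ∈ 𝒱.U p s := by
  simp only [U_eq_sumOver] at hU ⊢
  exact (𝒱.localFrame s).nabla01_sub_connection01_mem (hσ s hs)
    ((hN.eventually_mem hs).mono hU) ξ

theorem nabla10_sub_connection10_mem_U {p : ℤ} {N : Set S} (hN : IsOpen N) {σ : 𝒱.Sec}
    (hσ : 𝒱.IsSmoothOn E σ N) (hU : ∀ s ∈ N, σ s ∈ 𝒱.U p s) {s : S} (hs : s ∈ N) (ξ : E) :
    𝒱.nabla10 σ s ξ - (𝒱.localFrame s).connection10 ξ (σ s) ∈ 𝒱.U p s := by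
  simp only [U_eq_sumOver] at hU ⊢
  exact (𝒱.localFrame s).nabla10_sub_connection10_mem (hσ s hs)
    ((hN.eventually_mem hs).mono hU) ξ

/-- The decomposition of the Gauss–Manin connection relative to `⨁ 𝒰^p`: in a local frame, `τ` and
`θ` are the parts of the connection form that shift `p` by `1` and `-1`. -/
def decomposition : 𝒱.Decomposition where
  τ s := (shift (𝒱.isInternal_bigrading s) 1).comp (𝒱.localFrame s).connection01
  θ s := (shift (𝒱.isInternal_bigrading s) (-1)).comp (𝒱.localFrame s).connection10
  τ_mem s ξ p x hx := by
    rw [U_eq_sumOver] at hx ⊢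
    exact sumOver_fst_eq_le_comap_shift _ _ _ _ hx
  θ_mem s ξ p x hx := by
    rw [U_eq_sumOver] at hx ⊢
    exact sumOver_fst_eq_le_comap_shift _ _ _ _ hx
  dbar_mem p N hN σ hσ hU s hs ξ := by
    have hnabla := 𝒱.nabla01_sub_connection01_mem_U hN hσ hU hs ξ
    have hx := hU s hs
    rw [U_eq_sumOver] at hnabla hx ⊢
    have hshift := ((𝒱.localFrame s).isConnectionPair ξ).sumOver_fst_eq_le_comap_left_sub_shift
      (𝒱.isInternal_bigrading s) p hx
    exact sub_add_sub_cancel _ _ (_ : 𝒱.fiberC s) ▸ Submodule.add_mem _ hnabla hshift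
  d_mem p N hN σ hσ hU s hs ξ := by
    have hnabla := 𝒱.nabla10_sub_connection10_mem_U hN hσ hU hs ξ
    have hx := hU s hs
    rw [U_eq_sumOver] at hnabla hx ⊢
    have hshift := ((𝒱.localFrame s).isConnectionPair ξ).sumOver_fst_eq_le_comap_right_sub_shift
      (𝒱.isInternal_bigrading s) p hx
    exact sub_add_sub_cancel _ _ (_ : 𝒱.fiberC s) ▸ Submodule.add_mem _ hnabla hshift

theorem adWeightZero_conjEnd_θ_decomposition (s : S) (ξ : E) :
    adWeightZero (𝒱.Y s) (conjEnd (𝒱.decomposition.θ s ξ)) = 𝒱.decomposition.τ s ξ :=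
  have : FiniteDimensional ℂ (𝒱.fiberC s) := (𝒱.chartEquiv s).symm.finiteDimensional
  ((𝒱.localFrame s).isConnectionPair ξ).adWeightZero_conjOf_shift (𝒱.isInternal_bigrading s)
    fun _ _ => gradingOf_apply (𝒱.isInternal_bigrading s)

variable {𝒱} {s : S} {p q : ℤ}

theorem disjoint_U (hpq : p ≠ q) : Disjoint (𝒱.U p s) (𝒱.U q s) := by
  simp only [U_eq_sumOver]
  exact disjoint_sumOver (𝒱.isInternal_bigrading s).submodule_iSupIndep
    (Set.disjoint_left.2 fun _ hp hq => hpq (hp.symm.trans hq))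

theorem eq_of_sub_mem_U (hpq : p ≠ q) {x a b : 𝒱.fiberC s} (ha : a ∈ 𝒱.U q s) (hb : b ∈ 𝒱.U q s)
    (hxa : x - a ∈ 𝒱.U p s) (hxb : x - b ∈ 𝒱.U p s) : a = b := by
  rw [← sub_eq_zero]
  refine Submodule.disjoint_def.1 (disjoint_U hpq) _ ?_ (Submodule.sub_mem _ ha hb)
  simpa only [sub_sub_sub_cancel_left] using Submodule.sub_mem _ hxb hxa

theorem exists_section_mem_U {x : 𝒱.fiberC s} (hx : x ∈ 𝒱.U p s) :
    ∃ N, IsOpen N ∧ s ∈ N ∧ ∃ σ : 𝒱.Sec, 𝒱.IsSmoothOn E σ N ∧ σ s = x ∧ ∀ s ∈ N, σ s ∈ 𝒱.U p s := by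
  obtain ⟨N, hN, hs, σ, hσ, hσx, hσA⟩ := (𝒱.localFrame s).exists_section x
  simp only [U_eq_sumOver] at hx ⊢
  exact ⟨N, hN, hs, σ, hσ, hσx, fun s hs => hσA s hs _ hx⟩

theorem linearMap_ext_of_U {f g : Module.End ℂ (𝒱.fiberC s)}
    (hfg : ∀ p, ∀ x ∈ 𝒱.U p s, f x = g x) : f = g :=
  linearMap_ext_of_isInternal (𝒱.isInternal_bigrading s) fun i x hx =>
    hfg i.1 x (𝒱.U_eq_sumOver i.1 s ▸ le_sumOver (A := {j : ℤ × ℤ | j.1 = i.1}) rfl hx)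

namespace Decomposition

theorem unique (D D' : 𝒱.Decomposition) : D = D' := by
  refine Decomposition.ext (funext fun s => LinearMap.ext fun ξ => linearMap_ext_of_U ?_)
    (funext fun s => LinearMap.ext fun ξ => linearMap_ext_of_U ?_)
  all_goals
    intro p x hx
    obtain ⟨N, hN, hs, σ, hσ, rfl, hU⟩ := exists_section_mem_U hx
  · exact eq_of_sub_mem_U (by omega) (D.τ_mem s ξ p _ hx) (D'.τ_mem s ξ p _ hx)
      (D.dbar_mem p N hN σ hσ hU s hs ξ) (D'.dbar_mem p N hN σ hσ hU s hs ξ)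
  · exact eq_of_sub_mem_U (by omega) (D.θ_mem s ξ p _ hx) (D'.θ_mem s ξ p _ hx)
      (D.d_mem p N hN σ hσ hU s hs ξ) (D'.d_mem p N hN σ hσ hU s hs ξ)

theorem τ_eq_zero_of_nabla01_eq_zero (D : 𝒱.Decomposition) {N : Set S} (hN : IsOpen N)
    {σ : 𝒱.Sec} (hσ : 𝒱.IsSmoothOn E σ N) (hU : ∀ s ∈ N, σ s ∈ 𝒱.U p s) (hs : s ∈ N) {ξ : E}
    (hξ : 𝒱.nabla01 σ s ξ = 0) : D.τ s ξ (σ s) = 0 :=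
  eq_of_sub_mem_U (x := 0) (by omega : p ≠ p + 1) (D.τ_mem s ξ p _ (hU s hs)) (Submodule.zero_mem _)
    (hξ ▸ D.dbar_mem p N hN σ hσ hU s hs ξ) (by simp)

theorem isHolomorphicSubbundle_U_iff (D : 𝒱.Decomposition) (p : ℤ) :
    𝒱.IsHolomorphicSubbundle E (𝒱.U p) ↔ ∀ s (ξ : E), ∀ x ∈ 𝒱.U p s, D.τ s ξ x = 0 := by
  refine ⟨fun h s ξ => ?_, fun h s₀ => ?_⟩
  · obtain ⟨N, hN, hs, m, e, he, hspan⟩ := h s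
    have heU : ∀ j, ∀ s ∈ N, e j s ∈ 𝒱.U p s := fun j s hs =>
      (hspan s hs).2.le (Submodule.subset_span (Set.mem_range_self j))
    have hker : 𝒱.U p s ≤ LinearMap.ker (D.τ s ξ) := by
      rw [← (hspan s hs).2, Submodule.span_le]
      exact Set.range_subset_iff.2 fun j =>
        D.τ_eq_zero_of_nabla01_eq_zero hN (he j).1 (heU j) hs ((he j).2 s hs ξ)
    exact fun x hx => hker hx
  · obtain ⟨N, hN, hs₀, m, e, he, hspan, hzero⟩ :=
      RationalLocalSystem.exists_frame_nabla01_eq_zero_of_mem (𝒱.isSmoothFamily_map_U p s₀)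
    have heU : ∀ j, ∀ s ∈ N, e j s ∈ 𝒱.U p s := fun j s hs =>
      (hspan s hs).2.le (Submodule.subset_span (Set.mem_range_self j))
    refine ⟨N, hN, hs₀, m, e, fun j => ⟨he j, fun s hs ξ => hzero s hs j ξ ?_⟩, hspan⟩
    have hdbar := D.dbar_mem p N hN (e j) (he j) (heU j) s hs ξ
    rwa [h s ξ _ (heU j s hs), sub_zero] at hdbar

theorem isHolomorphicSubbundle_U_of_eq_bot (D : 𝒱.Decomposition)
    (hp : ∀ s, 𝒱.U (p + 1) s = ⊥) : 𝒱.IsHolomorphicSubbundle E (𝒱.U p) :=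
  (D.isHolomorphicSubbundle_U_iff p).2 fun s ξ x hx =>
    (Submodule.mem_bot ℂ).1 (hp s ▸ D.τ_mem s ξ p x hx)

end Decomposition

end VGPMHS

end Decomposition

end MixedHodge

end

theorem lemma5p22_general {E : Type*} [NormedAddCommGroup E] [NormedSpace ℂ E]
    {S : Type*} [TopologicalSpace S] [ChartedSpace E S] (𝒱 : MixedHodge.VGPMHS E S) :
    (∀ s, MixedHodge.IsDeligneBigrading (𝒱.W s) (𝒱.F s) (𝒱.I s)) ∧
    (∀ p, 𝒱.IsSmoothSubbundle E (𝒱.U p)) ∧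
    ∃ D : 𝒱.Decomposition, (∀ D' : 𝒱.Decomposition, D' = D) ∧
      (∀ s (ξ : E), D.τ s ξ = MixedHodge.adWeightZero (𝒱.Y s) (MixedHodge.conjEnd (D.θ s ξ))) ∧
      (∀ p, 𝒱.IsHolomorphicSubbundle E (𝒱.U p) ↔
        ∀ s (ξ : E), ∀ x ∈ 𝒱.U p s,
          MixedHodge.adWeightZero (𝒱.Y s) (MixedHodge.conjEnd (D.θ s ξ)) x = 0) ∧
      (∀ b : ℤ, (∀ p, b < p → ∀ s, 𝒱.U p s = ⊥) → 𝒱.IsHolomorphicSubbundle E (𝒱.U b)) := by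
  have hτ := 𝒱.adWeightZero_conjEnd_θ_decomposition
  refine ⟨𝒱.isDeligneBigrading, 𝒱.isSmoothSubbundle_U, 𝒱.decomposition, fun D' => D'.unique _,
    fun s ξ => (hτ s ξ).symm, fun p => ?_,
    fun b hb => 𝒱.decomposition.isHolomorphicSubbundle_U_of_eq_bot (hb (b + 1) (lt_add_one b))⟩
  simpa only [hτ] using 𝒱.decomposition.isHolomorphicSubbundle_U_iff p

theorem lemma5p22 {E : Type*} [NormedAddCommGroup E] [NormedSpace ℂ E] [FiniteDimensional ℂ E]
    {S : Type*} [TopologicalSpace S] [ChartedSpace E S] [IsManifold 𝓘(ℂ, E) ω S]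
    (𝒱 : MixedHodge.VGPMHS E S) :
    (∀ s, MixedHodge.IsDeligneBigrading (𝒱.W s) (𝒱.F s) (𝒱.I s)) ∧
    (∀ p, 𝒱.IsSmoothSubbundle E (𝒱.U p)) ∧
    ∃ D : 𝒱.Decomposition, (∀ D' : 𝒱.Decomposition, D' = D) ∧
      (∀ s (ξ : E), D.τ s ξ = MixedHodge.adWeightZero (𝒱.Y s) (MixedHodge.conjEnd (D.θ s ξ))) ∧
      (∀ p, 𝒱.IsHolomorphicSubbundle E (𝒱.U p) ↔
        ∀ s (ξ : E), ∀ x ∈ 𝒱.U p s,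
          MixedHodge.adWeightZero (𝒱.Y s) (MixedHodge.conjEnd (D.θ s ξ)) x = 0) ∧
      (∀ b : ℤ, (∀ p, b < p → ∀ s, 𝒱.U p s = ⊥) → 𝒱.IsHolomorphicSubbundle E (𝒱.U b)) :=
  lemma5p22_general 𝒱
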